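/- Let $d\ge 1$, let $\Omega\subset\mathbb R^d$ be a bounded open set (in particular, $\Omega$ may be a bounded Lipschitz domain), let $T>0$, $I=(0,T)$. The space $H_0^1(\Omega)$ carries the norm $\|z\|_{H_0^1(\Omega)}=\|\nabla z\|_{L^2(\Omega)}$, $\Delta:H_0^1(\Omega)\to H^{-1}(\Omega)$ is the distributional Laplacian, and $H^1_\star(I;H_0^1(\Omega))=\{v\in H^1(I;H_0^1(\Omega)):v(0)=0\}$. Let $\mathcal D(v)=\int_\Omega|v|\,dx$ on $H_0^1(\Omega)$, with subdifferential $\partial\mathcal D(v)\subset H^{-1}(\Omega)$, and let $\mathcal G$ be the set of all $g\in H^1(I;L^2(\Omega))$ with $\|g(0)\|_{L^\infty(\Omega)}\le 1$. Let $\{|\cdot|_\rho\}_{\rho>0}$ be a family of convex, even functions in $C^{2,1}(\mathbb R,\mathbb R)$ with $|v|_\rho=|v|$ for $|v|\ge\rho$ and $|v|_\rho''\le 2/\rho$ for all $v\in\mathbb R$. For $g\in\mathcal G$ let $z=\mathcal S(g)\in H^1_\star(I;H_0^1(\Omega))$ be the solution of $$0\in\partial\mathcal D(\dot z)-\Delta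 z-g\quad\text{in }H^{-1}(\Omega),\text{ a.e. in }I,$$ and for $\rho>0$ and $g\in H^1(I;L^2(\Omega))$ let $z=\mathcal S_\rho(g)\in H^1_\star(I;H_0^1(\Omega))$ be the solution of $$|\dot z|_\rho'-\rho\,\Delta\dot z-\Delta z=g\quad\text{in }H^{-1}(\Omega),\text{ a.e. in }I.$$ Both operators are well defined, i.e. these solutions exist and are unique, and the following holds. (a) Let $g_n\in\mathcal G$ for all $n\in\mathbb N$, let $g_n\rightharpoonup g$ weakly in $H^1(I;L^2(\Omega))$, and let $\rho_n>0$ with $\rho_n\to0$. Then $g\in\mathcal G$, and $\mathcal S_{\rho_n}(g_n)\rightharpoonup\mathcal S(g)$ weakly in $H^1_\star(I;H_0^1(\Omega))$ and $\mathcal S_{\rho_n}(g_n)\to\mathcal S(g)$ strongly in $C(\bar I;H_0^1(\Omega))$. (b) There is a constant $C>0$, independent of $g$ and $\rho$, such that for all $g\in\mathcal G$ and all $\rho>0$ $$\|\mathcal S(g)-\mathcal S_\rho(g)\|_{C(\bar I;H_0^1(\Omega))}\le C\,\bigl(1+\|\mathcal S(g)\|_{H^1(I;H_0^1(\Omega))}\bigr)\,\rho^{1/2}.$$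 -/

import Mathlib

open MeasureTheory Set Filter Topology
open scoped ContDiff

noncomputable section

/-- Lebesgue measure on the time interval `I = (0, T)`. -/
abbrev timeMeasure (T : ℝ) : Measure ℝ := volume.restrict (Ioo 0 T)

section Bochner
variable {X : Type*} [NormedAddCommGroup X] [InnerProductSpace ℝ X] [CompleteSpace X]

/-- `v` is the weak (distributional) derivative of `u` on `I = (0, T)`. -/
def IsWeakDeriv (T : ℝ) (u v : ℝ → X) : Prop :=
  ∀ φ : ℝ → ℝ, ContDiff ℝ ∞ φ → HasCompactSupport φ → tsupport φ ⊆ Ioo 0 T →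
    ∫ t in Ioo 0 T, deriv φ t • u t = - ∫ t in Ioo 0 T, φ t • v t

lemma integrable_smul_test {Y : Type*} [NormedAddCommGroup Y] [NormedSpace ℝ Y] {T : ℝ}
    {φ : ℝ → ℝ} (hφ : Continuous φ) {u : ℝ → Y}
    (hu : Integrable u (timeMeasure T)) :
    Integrable (fun t => φ t • u t) (timeMeasure T) := by
  obtain ⟨M, hM⟩ := (isCompact_Icc (a := (0:ℝ)) (b := T)).exists_bound_of_continuousOn
    hφ.continuousOn
  refine hu.bdd_smul M hφ.aestronglyMeasurable ?_
  filter_upwards [ae_restrict_mem measurableSet_Ioo] with t ht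
  exact hM t (Ioo_subset_Icc_self ht)

lemma integral_deriv_smul_primitive {T : ℝ} {φ : ℝ → ℝ} (hφ : ContDiff ℝ ∞ φ)
    (hs : tsupport φ ⊆ Ioo 0 T) {v : ℝ → X} (hv : Integrable v (timeMeasure T)) :
    ∫ t in Ioo 0 T, deriv φ t • (∫ s in (0:ℝ)..t, v s) = - ∫ t in Ioo 0 T, φ t • v t := by
  have hd : Continuous (deriv φ) := hφ.continuous_deriv (by simp)
  have hφT : φ T = 0 := by
    by_contra h
    exact absurd (hs (subset_tsupport _ h)) (by simp)
  obtain ⟨M, hM⟩ := (isCompact_Icc (a := (0:ℝ)) (b := T)).exists_bound_of_continuousOn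
    hd.continuousOn
  let F : ℝ → ℝ → X := fun t s => (if s < t then deriv φ t else 0) • v s
  have hF : Integrable (Function.uncurry F) ((timeMeasure T).prod (timeMeasure T)) := by
    have h1 : Integrable (fun p : ℝ × ℝ => v p.2) ((timeMeasure T).prod (timeMeasure T)) :=
      hv.comp_snd _
    refine h1.bdd_smul (φ := fun p : ℝ × ℝ => if p.2 < p.1 then deriv φ p.1 else 0) M ?_ ?_
    · refine (Measurable.ite (measurableSet_lt measurable_snd measurable_fst)
        (hd.measurable.comp measurable_fst) measurable_const).aestronglyMeasurable
    · have : ∀ᵐ p ∂((timeMeasure T).prod (timeMeasure T)), p ∈ Ioo 0 T ×ˢ Ioo 0 T := by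
        rw [Measure.prod_restrict]
        exact ae_restrict_mem (measurableSet_Ioo.prod measurableSet_Ioo)
      filter_upwards [this] with p hp
      have := hM p.1 (Ioo_subset_Icc_self hp.1)
      split_ifs
      · exact this
      · simpa using (norm_nonneg _).trans this
  have hswap := integral_integral_swap hF
  have hL : ∫ t in Ioo 0 T, deriv φ t • (∫ s in (0:ℝ)..t, v s) =
      ∫ t in Ioo 0 T, ∫ s in Ioo 0 T, F t s := by
    refine setIntegral_congr_fun measurableSet_Ioo fun t ht => ?_
    simp only [F]
    have : ∀ s, (if s < t then deriv φ t else 0) • v s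
        = deriv φ t • (Iio t).indicator v s := by
      intro s; by_cases h : s < t <;> simp [h]
    simp_rw [this]
    rw [integral_smul, setIntegral_indicator measurableSet_Iio,
      intervalIntegral.integral_of_le ht.1.le, integral_Ioc_eq_integral_Ioo]
    congr 3
    ext s
    simp only [mem_Ioo, mem_inter_iff, mem_Iio]
    constructor
    · rintro ⟨a, b⟩; exact ⟨⟨a, b.trans ht.2⟩, b⟩
    · rintro ⟨⟨a, _⟩, b⟩; exact ⟨a, b⟩
  have hR : ∫ s in Ioo 0 T, ∫ t in Ioo 0 T, F t s = ∫ s in Ioo 0 T, - (φ s • v s) := by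
    refine setIntegral_congr_fun measurableSet_Ioo fun s hs' => ?_
    simp only [F]
    rw [integral_smul_const, ← neg_smul]
    congr 1
    have : ∀ t, (if s < t then deriv φ t else 0) = (Ioi s).indicator (deriv φ) t := by
      intro t; by_cases h : s < t <;> simp [h]
    simp_rw [this]
    rw [setIntegral_indicator measurableSet_Ioi]
    have hset : Ioo 0 T ∩ Ioi s = Ioo s T := by
      ext t
      simp only [mem_Ioo, mem_inter_iff, mem_Ioi]
      constructor
      · rintro ⟨⟨_, a⟩, b⟩; exact ⟨b, a⟩
      · rintro ⟨a, b⟩; exact ⟨⟨hs'.1.trans a, b⟩, a⟩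
    rw [hset, ← integral_Ioc_eq_integral_Ioo, ← intervalIntegral.integral_of_le hs'.2.le,
      intervalIntegral.integral_deriv_eq_sub
        (fun x _ => (hφ.differentiable (by simp)).differentiableAt)
        (hd.intervalIntegrable _ _), hφT, zero_sub]
  rw [hL, hswap, hR, integral_neg]

lemma exists_primitive_test {T : ℝ} {χ : ℝ → ℝ} (hχ : ContDiff ℝ ∞ χ)
    (hc : HasCompactSupport χ) (hs : tsupport χ ⊆ Ioo 0 T) (h0 : ∫ t, χ t = 0) :
    ∃ η : ℝ → ℝ, ContDiff ℝ ∞ η ∧ HasCompactSupport η ∧ tsupport η ⊆ Ioo 0 T ∧ deriv η = χ := by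
  by_cases hne : (tsupport χ).Nonempty
  swap
  · have : χ = 0 := by
      rw [Set.not_nonempty_iff_eq_empty, tsupport_eq_empty_iff] at hne
      exact hne
    refine ⟨0, contDiff_const, HasCompactSupport.zero, by simp, ?_⟩
    rw [this]; ext; simp
  obtain ⟨a, ha, hamin⟩ := hc.exists_isLeast hne
  obtain ⟨b, hb, hbmax⟩ := hc.exists_isGreatest hne
  have hsub : ∀ t, χ t ≠ 0 → t ∈ Icc a b := fun t ht =>
    ⟨hamin (subset_tsupport _ ht), hbmax (subset_tsupport _ ht)⟩
  let η : ℝ → ℝ := fun t => ∫ s in a..t, χ s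
  have hder : ∀ t, HasDerivAt η (χ t) t := fun t =>
    intervalIntegral.integral_hasDerivAt_right (hχ.continuous.intervalIntegrable _ _)
      (hχ.continuous.stronglyMeasurableAtFilter _ _) hχ.continuous.continuousAt
  have hderiv : deriv η = χ := funext fun t => (hder t).deriv
  have hsupp : Function.support η ⊆ Icc a b := by
    intro t ht
    by_contra hmem
    apply ht
    rw [mem_Icc, not_and_or, not_le, not_le] at hmem
    rcases hmem with h | h
    · refine (intervalIntegral.integral_congr_ae (g := fun _ => (0:ℝ)) ?_).trans (by simp)
      have : ∀ᵐ s : ℝ, s ≠ a := by simp [ae_iff]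
      filter_upwards [this] with s hsa hs'
      rw [uIoc_of_ge h.le] at hs'
      by_contra hne'
      exact hsa (le_antisymm hs'.2 (hsub s hne').1)
    · have hab : a ≤ b := hamin hb
      rw [← h0]
      show ∫ s in a..t, χ s = _
      rw [intervalIntegral.integral_of_le (hab.trans h.le), ← integral_Icc_eq_integral_Ioc]
      refine setIntegral_eq_integral_of_forall_compl_eq_zero fun s hs' => ?_
      by_contra hne'
      exact hs' ⟨(hsub s hne').1, (hsub s hne').2.trans h.le⟩
  have htsupp : tsupport η ⊆ Icc a b := closure_minimal hsupp isClosed_Icc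
  refine ⟨η, ?_, ?_, ?_, hderiv⟩
  · rw [contDiff_infty_iff_deriv]
    exact ⟨fun t => (hder t).differentiableAt, hderiv ▸ hχ⟩
  · exact HasCompactSupport.of_support_subset_isCompact isCompact_Icc hsupp
  · exact htsupp.trans fun t ht => ⟨(hs ha).1.trans_le ht.1, ht.2.trans_lt (hs hb).2⟩

/-- A function with an integrable weak derivative is, up to a null set, a constant plus the
primitive of its weak derivative. -/
lemma IsWeakDeriv.exists_eq_primitive {T : ℝ} {u v : ℝ → X}
    (hu : Integrable u (timeMeasure T)) (hv : Integrable v (timeMeasure T))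
    (h : IsWeakDeriv T u v) :
    ∃ c : X, u =ᵐ[timeMeasure T] fun t => c + ∫ s in (0:ℝ)..t, v s := by
  rcases le_or_gt T 0 with hT | hT
  · exact ⟨0, by simp [timeMeasure, Ioo_eq_empty (not_lt.2 hT), Filter.EventuallyEq]⟩
  have hvI : IntervalIntegrable v volume 0 T := by
    rw [intervalIntegrable_iff_integrableOn_Ioo_of_le hT.le]; exact hv
  let V : ℝ → X := fun t => ∫ s in (0:ℝ)..t, v s
  have hVc : ContinuousOn V (Icc 0 T) :=
    intervalIntegral.continuousOn_primitive_interval'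
      hvI (by simp [hT.le]) |>.mono (by rw [uIcc_of_le hT.le])
  have hVi : Integrable V (timeMeasure T) :=
    (hVc.integrableOn_Icc).mono_set Ioo_subset_Icc_self
  let w : ℝ → X := fun t => u t - V t
  have hw : Integrable w (timeMeasure T) := hu.sub hVi
  have key : ∀ χ : ℝ → ℝ, ContDiff ℝ ∞ χ → HasCompactSupport χ → tsupport χ ⊆ Ioo 0 T →
      ∫ t, χ t = 0 → ∫ t in Ioo 0 T, χ t • w t = 0 := by
    intro χ h1 h2 h3 h4
    obtain ⟨η, e1, e2, e3, e4⟩ := exists_primitive_test h1 h2 h3 h4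
    have a1 := h η e1 e2 e3
    have a2 := integral_deriv_smul_primitive e1 e3 hv
    rw [e4] at a1 a2
    simp only [w, smul_sub]
    rw [integral_sub (integrable_smul_test h1.continuous hu)
      (integrable_smul_test h1.continuous hVi), a1, a2, sub_self]
  let B : ContDiffBump (T / 2) := ⟨T / 8, T / 4, by linarith, by linarith⟩
  let ψ : ℝ → ℝ := B.normed volume
  have p1 : ContDiff ℝ ∞ ψ := B.contDiff_normed
  have p2 : HasCompactSupport ψ := B.hasCompactSupport_normed
  have p3 : tsupport ψ ⊆ Ioo 0 T := by
    rw [B.tsupport_normed_eq, Real.closedBall_eq_Icc]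
    intro t ht
    simp only [B, mem_Icc] at ht
    exact ⟨by linarith, by linarith⟩
  have p4 : ∫ t, ψ t = 1 := B.integral_normed
  let K : X := ∫ t in Ioo 0 T, ψ t • w t
  have main : ∀ᵐ t ∂(volume : Measure ℝ), t ∈ Ioo 0 T → w t - K = 0 := by
    refine isOpen_Ioo.ae_eq_zero_of_integral_contDiff_smul_eq_zero ?_ ?_
    · refine IntegrableOn.locallyIntegrableOn ?_
      exact hw.sub (integrable_const _)
    intro φ h1 h2 h3
    have hφi : Integrable φ := h1.continuous.integrable_of_hasCompactSupport h2
    have hψi : Integrable ψ := p1.continuous.integrable_of_hasCompactSupport p2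
    let c : ℝ := ∫ t, φ t
    have hset : ∀ f : ℝ → X, ∫ t, φ t • f t = ∫ t in Ioo 0 T, φ t • f t := fun f =>
      (setIntegral_eq_integral_of_forall_compl_eq_zero fun t ht => by
        rw [image_eq_zero_of_notMem_tsupport fun hh => ht (h3 hh), zero_smul]).symm
    have hcI : ∫ t in Ioo 0 T, φ t = c :=
      setIntegral_eq_integral_of_forall_compl_eq_zero fun t ht =>
        image_eq_zero_of_notMem_tsupport fun hh => ht (h3 hh)
    have hk := key (fun t => φ t - c * ψ t) (h1.sub (contDiff_const.mul p1))
      (h2.sub (p2.mul_left)) ?_ ?_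
    · have e : ∫ t in Ioo 0 T, (φ t - c * ψ t) • w t
          = (∫ t in Ioo 0 T, φ t • w t) - c • K := by
        simp only [sub_smul, mul_smul]
        rw [integral_sub (integrable_smul_test h1.continuous hw)
          (by exact (integrable_smul_test p1.continuous hw).smul c), integral_smul]
      rw [e] at hk
      rw [hset]
      simp only [smul_sub]
      rw [integral_sub (integrable_smul_test h1.continuous hw)
        (integrable_smul_test h1.continuous (integrable_const K)), integral_smul_const, hcI]
      exact hk
    · refine (tsupport_sub _ _).trans (union_subset h3 ?_)
      exact (closure_mono (Function.support_mul_subset_right _ _)).trans p3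
    · rw [integral_sub hφi (hψi.const_mul c), integral_const_mul, p4, mul_one, sub_self]
  refine ⟨K, ?_⟩
  rw [timeMeasure, Filter.EventuallyEq, ae_restrict_iff' measurableSet_Ioo]
  filter_upwards [main] with t ht hmem
  have := ht hmem
  simp only [w, V, sub_sub, sub_eq_zero] at this
  rw [this, add_comm]

lemma integrable_Lp_time {Y : Type*} [NormedAddCommGroup Y] {T : ℝ} (u : Lp Y 2 (timeMeasure T)) :
    Integrable u (timeMeasure T) :=
  (Lp.memLp u).integrable (by norm_num)

variable (X) in
/-- The Bochner-Sobolev space `H¹(I; X)`, `I = (0, T)`: pairs `(u, u')` in `L²(I; X) × L²(I; X)`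
such that `u'` is the weak derivative of `u`. It inherits the norm
`(‖u‖² + ‖u'‖²)^(1/2)`. -/
def H1 (T : ℝ) : Submodule ℝ (WithLp 2 (Lp X 2 (timeMeasure T) × Lp X 2 (timeMeasure T))) where
  carrier := {p | IsWeakDeriv T p.fst p.snd}
  zero_mem' := by
    intro φ h1 h2 h3
    have h : ((0 : Lp X 2 (timeMeasure T)) : ℝ → X) =ᵐ[timeMeasure T] 0 := Lp.coeFn_zero _ _ _
    have e : ∀ f : ℝ → ℝ, ∫ t in Ioo 0 T, f t • (0 : Lp X 2 (timeMeasure T)) t = 0 := by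
      intro f
      refine (integral_congr_ae (g := fun _ => (0 : X)) ?_).trans (by simp)
      filter_upwards [h] with t ht
      rw [ht]; simp
    exact (e _).trans (by rw [WithLp.zero_snd, e, neg_zero])
  add_mem' := by
    intro p q hp hq φ h1 h2 h3
    have hd : Continuous (deriv φ) := h1.continuous_deriv (by simp)
    have e : ∀ (f : ℝ → ℝ), Continuous f → ∀ a b : Lp X 2 (timeMeasure T),
        ∫ t in Ioo 0 T, f t • (a + b : Lp X 2 (timeMeasure T)) t
          = (∫ t in Ioo 0 T, f t • a t) + ∫ t in Ioo 0 T, f t • b t := by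
      intro f hf a b
      rw [← integral_add (integrable_smul_test hf (integrable_Lp_time a))
        (integrable_smul_test hf (integrable_Lp_time b))]
      refine integral_congr_ae ?_
      filter_upwards [Lp.coeFn_add a b] with t ht
      rw [ht, Pi.add_apply, smul_add]
    rw [WithLp.add_fst, WithLp.add_snd, e _ hd, e _ h1.continuous, hp φ h1 h2 h3, hq φ h1 h2 h3,
      neg_add]
  smul_mem' := by
    intro c p hp φ h1 h2 h3
    have e : ∀ (f : ℝ → ℝ) (a : Lp X 2 (timeMeasure T)),
        ∫ t in Ioo 0 T, f t • (c • a : Lp X 2 (timeMeasure T)) t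
          = c • ∫ t in Ioo 0 T, f t • a t := by
      intro f a
      rw [← integral_smul]
      refine integral_congr_ae ?_
      filter_upwards [Lp.coeFn_smul c a] with t ht
      rw [ht, Pi.smul_apply, smul_comm]
    rw [WithLp.smul_fst, WithLp.smul_snd, e, e, hp φ h1 h2 h3, smul_neg]

/-- The function underlying an element of `H¹(I; X)`, as a class in `L²(I; X)`. -/
def H1.val {T : ℝ} (u : H1 X T) : Lp X 2 (timeMeasure T) := u.1.fst

/-- The weak time derivative of an element of `H¹(I; X)`. -/
def H1.der {T : ℝ} (u : H1 X T) : Lp X 2 (timeMeasure T) := u.1.snd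

/-- `f` is a representative of `u ∈ H¹(I; X)` that is continuous on `[0, T]`. -/
def IsContRep {T : ℝ} (u : H1 X T) (f : ℝ → X) : Prop :=
  ContinuousOn f (Icc 0 T) ∧ (H1.val u) =ᵐ[timeMeasure T] f

lemma H1.exists_isContRep {T : ℝ} (u : H1 X T) : ∃ f : ℝ → X, IsContRep u f := by
  obtain ⟨c, hc⟩ := IsWeakDeriv.exists_eq_primitive (integrable_Lp_time (H1.val u))
    (integrable_Lp_time (H1.der u)) u.2
  refine ⟨_, ?_, hc⟩
  rcases le_or_gt T 0 with hT | hT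
  · exact (Set.subsingleton_Icc_of_ge hT).continuousOn _
  · have hvI : IntervalIntegrable (H1.der u) volume 0 T := by
      rw [intervalIntegrable_iff_integrableOn_Ioo_of_le hT.le]; exact integrable_Lp_time (H1.der u)
    exact continuousOn_const.add ((intervalIntegral.continuousOn_primitive_interval'
      hvI (by simp [hT.le])).mono (by rw [uIcc_of_le hT.le]))

lemma IsContRep.eqOn {T : ℝ} (hT : 0 < T) {u : H1 X T} {f f' : ℝ → X} (h : IsContRep u f)
    (h' : IsContRep u f') : EqOn f f' (Icc 0 T) := by
  have : f =ᵐ[volume.restrict (Icc 0 T)] f' := by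
    rw [← restrict_Ioo_eq_restrict_Icc]
    exact h.2.symm.trans h'.2
  exact Measure.eqOn_Icc_of_ae_eq volume hT.ne this h.1 h'.1

/-- The continuous representative of `u ∈ H¹(I; X)`; `H1.rep u t` is the value of `u` at
`t ∈ [0, T]`. -/
def H1.rep {T : ℝ} (u : H1 X T) : ℝ → X := (H1.exists_isContRep u).choose

lemma H1.isContRep_rep {T : ℝ} (u : H1 X T) : IsContRep u (H1.rep u) :=
  (H1.exists_isContRep u).choose_spec

/-- The embedding `H¹(I; X) → C([0, T]; X)`; the target carries the supremum norm. -/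
def H1.toC {T : ℝ} (u : H1 X T) : C(Icc (0 : ℝ) T, X) :=
  ⟨(Icc 0 T).domRestrict (H1.rep u), (H1.isContRep_rep u).1.domRestrict⟩

variable (X) in
/-- The space `H¹_⋆(I; X)` of those `u ∈ H¹(I; X)` with `u(0) = 0`. -/
def H1Star (T : ℝ) : Submodule ℝ (H1 X T) where
  carrier := {u | ∃ f, IsContRep u f ∧ f 0 = 0}
  zero_mem' := ⟨fun _ => 0, ⟨continuousOn_const, Lp.coeFn_zero _ _ _⟩, rfl⟩
  add_mem' := by
    rintro u v ⟨f, hf, hf0⟩ ⟨f', hf', hf'0⟩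
    exact ⟨f + f', ⟨hf.1.add hf'.1, (Lp.coeFn_add _ _).trans (hf.2.add hf'.2)⟩, by
      simp [hf0, hf'0]⟩
  smul_mem' := by
    rintro c u ⟨f, hf, hf0⟩
    exact ⟨c • f, ⟨hf.1.const_smul c, (Lp.coeFn_smul _ _).trans (hf.2.const_smul c)⟩, by
      simp [hf0]⟩

lemma mem_H1Star_iff {T : ℝ} (hT : 0 < T) (u : H1 X T) : u ∈ H1Star X T ↔ (H1.rep u) 0 = 0 :=
  ⟨fun ⟨_, hf, hf0⟩ => ((H1.isContRep_rep u).eqOn hT hf ⟨le_rfl, hT.le⟩).trans hf0,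
    fun h => ⟨_, (H1.isContRep_rep u), h⟩⟩

end Bochner

/-- Weak convergence of a sequence in a normed space. -/
def TendstoWeakly {E : Type*} [NormedAddCommGroup E] [NormedSpace ℝ E] (x : ℕ → E) (a : E) :
    Prop :=
  ∀ ℓ : StrongDual ℝ E, Tendsto (fun n => ℓ (x n)) atTop (𝓝 (ℓ a))

/-- The subdifferential of `D : E → ℝ` at `x`, a subset of the dual of `E`. -/
def subdifferential {E : Type*} [NormedAddCommGroup E] [NormedSpace ℝ E] (D : E → ℝ) (x : E) :
    Set (StrongDual ℝ E) :=
  {ξ | ∀ y, D x + ξ (y - x) ≤ D y}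

/-- A bounded open subset of `ℝ^d`. -/
structure BoundedOpen (d : ℕ) where
  carrier : Set (EuclideanSpace ℝ (Fin d))
  isOpen : IsOpen carrier
  isBounded : Bornology.IsBounded carrier

/-- Lebesgue measure on `Ω`. -/
abbrev BoundedOpen.measure {d : ℕ} (Ω : BoundedOpen d) : Measure (EuclideanSpace ℝ (Fin d)) :=
  volume.restrict Ω.carrier

/-- The space `L²(Ω)`. -/
abbrev L2 {d : ℕ} (Ω : BoundedOpen d) : Type := Lp ℝ 2 Ω.measure

/-- The space `L²(Ω; ℝ^d)`. -/
abbrev L2Vec {d : ℕ} (Ω : BoundedOpen d) : Type := Lp (EuclideanSpace ℝ (Fin d)) 2 Ω.measure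

section Domain
variable {d : ℕ}

instance (Ω : BoundedOpen d) : IsFiniteMeasure Ω.measure :=
  ⟨by simpa using Ω.isBounded.measure_lt_top⟩

/-- The pairs `(φ, ∇φ)` with `φ ∈ C_c^∞(Ω)`, as elements of `L²(Ω) × L²(Ω; ℝ^d)`. -/
def testPairs (Ω : BoundedOpen d) : Submodule ℝ (L2 Ω × L2Vec Ω) where
  carrier := {p | ∃ φ : EuclideanSpace ℝ (Fin d) → ℝ, ContDiff ℝ ∞ φ ∧ HasCompactSupport φ ∧
    tsupport φ ⊆ Ω.carrier ∧ p.1 =ᵐ[Ω.measure] φ ∧ p.2 =ᵐ[Ω.measure] gradient φ}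
  zero_mem' := by
    refine ⟨fun _ => 0, contDiff_const, HasCompactSupport.zero, ?_, ?_, ?_⟩
    · simp [tsupport]
    · exact Lp.coeFn_zero _ _ _
    · filter_upwards [Lp.coeFn_zero (EuclideanSpace ℝ (Fin d)) 2 Ω.measure] with x hx
      rw [Prod.snd_zero, hx]
      simp [gradient]
  add_mem' := by
    rintro p q ⟨φ, a1, a2, a3, a4, a5⟩ ⟨ψ, b1, b2, b3, b4, b5⟩
    refine ⟨φ + ψ, a1.add b1, a2.add b2, (tsupport_add _ _).trans (union_subset a3 b3), ?_, ?_⟩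
    · exact (Lp.coeFn_add _ _).trans (a4.add b4)
    · refine (Lp.coeFn_add _ _).trans ((a5.add b5).trans (Eventually.of_forall fun x => ?_))
      simp only [gradient, Pi.add_apply]
      rw [fderiv_add (a1.differentiable (by simp)).differentiableAt
        (b1.differentiable (by simp)).differentiableAt, map_add]
  smul_mem' := by
    rintro c p ⟨φ, a1, a2, a3, a4, a5⟩
    refine ⟨c • φ, a1.const_smul c, a2.mono (Function.support_const_smul_subset c φ),
      (closure_mono (Function.support_const_smul_subset c φ)).trans a3, ?_, ?_⟩
    · exact (Lp.coeFn_smul _ _).trans (a4.const_smul c)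
    · refine (Lp.coeFn_smul _ _).trans ((a5.const_smul c).trans (Eventually.of_forall fun x => ?_))
      simp only [gradient, Pi.smul_apply]
      rw [fderiv_const_smul (a1.differentiable (by simp)).differentiableAt, map_smul]

/-- A Poincaré inequality for test functions. -/
lemma poincare_test [NeZero d] {φ : EuclideanSpace ℝ (Fin d) → ℝ} {R : ℝ}
    (h1 : ContDiff ℝ ∞ φ) (h2 : HasCompactSupport φ) (hR : ∀ x ∈ tsupport φ, ‖x‖ ≤ R) :
    ∫ x, φ x ^ 2 ≤ (2 * R) ^ 2 * ∫ x, ‖gradient φ x‖ ^ 2 := by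
  let i : Fin d := 0
  let e : EuclideanSpace ℝ (Fin d) := EuclideanSpace.single i 1
  have hd : Differentiable ℝ φ := h1.differentiable (by simp)
  have hc : Continuous φ := h1.continuous
  have hfc : Continuous (fderiv ℝ φ) := h1.continuous_fderiv (by simp)
  have hgc : Continuous (gradient φ) :=
    (InnerProductSpace.toDual ℝ (EuclideanSpace ℝ (Fin d))).symm.continuous.comp hfc
  have hnorm : ∀ x, ‖gradient φ x‖ = ‖fderiv ℝ φ x‖ := fun x => by simp [gradient]
  have hgs : HasCompactSupport (gradient φ) := by
    refine (h2.fderiv (𝕜 := ℝ)).mono fun x hx => ?_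
    rw [Function.mem_support] at hx ⊢
    intro h; exact hx (by simp [gradient, h])
  have hcoord : ∀ x : EuclideanSpace ℝ (Fin d), HasFDerivAt
      (fun x : EuclideanSpace ℝ (Fin d) => x i) (EuclideanSpace.proj i : _ →L[ℝ] ℝ) x :=
    fun x => (EuclideanSpace.proj i : EuclideanSpace ℝ (Fin d) →L[ℝ] ℝ).hasFDerivAt
  have hci : Continuous (fun x : EuclideanSpace ℝ (Fin d) => x i) :=
    (EuclideanSpace.proj i : EuclideanSpace ℝ (Fin d) →L[ℝ] ℝ).continuous
  have hsq : ∀ x, HasFDerivAt (fun y => φ y * φ y) (φ x • fderiv ℝ φ x + φ x • fderiv ℝ φ x) x :=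
    fun x => (hd x).hasFDerivAt.mul (hd x).hasFDerivAt
  have hsc : HasCompactSupport (fun y => φ y * φ y) := h2.mul_left
  have hec : Continuous (fun x => fderiv ℝ φ x e) := hfc.clm_apply continuous_const
  have ibp := integral_bilinear_hasFDerivAt_right_eq_neg_left_of_integrable
    (μ := (volume : Measure (EuclideanSpace ℝ (Fin d)))) (v := e) (B := ContinuousLinearMap.mul ℝ ℝ)
    (f := fun x : EuclideanSpace ℝ (Fin d) => x i)
    (f' := fun _ => (EuclideanSpace.proj i : _ →L[ℝ] ℝ))
    (g := fun y => φ y * φ y) (g' := fun x => φ x • fderiv ℝ φ x + φ x • fderiv ℝ φ x)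
    ?_ ?_ ?_ (fun x _ => hcoord x) (fun x _ => hsq x)
  rotate_left
  · refine Continuous.integrable_of_hasCompactSupport ?_ ?_
    · simp; fun_prop
    · exact HasCompactSupport.mul_left (f := fun _ => _) hsc
  · refine Continuous.integrable_of_hasCompactSupport ?_ ?_
    · simp; fun_prop
    · refine h2.mono fun x hx => ?_
      rw [Function.mem_support] at hx ⊢
      intro h; exact hx (by simp [h])
  · refine Continuous.integrable_of_hasCompactSupport ?_ ?_
    · simp; fun_prop
    · exact HasCompactSupport.mul_left (f := fun x : EuclideanSpace ℝ (Fin d) => x i) hsc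
  have hI : Integrable (fun x => φ x ^ 2) := Continuous.integrable_of_hasCompactSupport
    (by fun_prop) (by simpa [pow_two] using hsc)
  have hG : Integrable (fun x => ‖gradient φ x‖ ^ 2) := by
    refine Continuous.integrable_of_hasCompactSupport (by fun_prop) ?_
    refine hgs.mono fun x hx => ?_
    rw [Function.mem_support] at hx ⊢
    intro h; exact hx (by simp [h])
  have he : (EuclideanSpace.proj i : EuclideanSpace ℝ (Fin d) →L[ℝ] ℝ) e = 1 := by simp [e]
  simp only [ContinuousLinearMap.mul_apply', he, one_mul, add_apply,
    smul_apply, smul_eq_mul] at ibp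
  have hpt : ∀ x, -(x i * (φ x * fderiv ℝ φ x e + φ x * fderiv ℝ φ x e)) ≤
      2⁻¹ * φ x ^ 2 + 2 * R ^ 2 * ‖gradient φ x‖ ^ 2 := by
    intro x
    by_cases hx : x ∈ tsupport φ
    · have b1 : |x i| ≤ R := (by simpa using PiLp.norm_apply_le x i : |x i| ≤ ‖x‖).trans (hR x hx)
      have b2 : |fderiv ℝ φ x e| ≤ ‖gradient φ x‖ := by
        rw [hnorm]
        simpa [e] using (fderiv ℝ φ x).le_opNorm e
      have b3 : |x i * fderiv ℝ φ x e| ≤ R * ‖gradient φ x‖ := by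
        rw [abs_mul]; gcongr; exact (abs_nonneg _).trans b1
      have b4 : (x i * fderiv ℝ φ x e) ^ 2 ≤ (R * ‖gradient φ x‖) ^ 2 := by
        rw [← sq_abs]; gcongr
      nlinarith [sq_nonneg (φ x + 2 * (x i * fderiv ℝ φ x e))]
    · rw [image_eq_zero_of_notMem_tsupport hx]
      simp only [zero_mul, add_zero, mul_zero, neg_zero]
      positivity
  have hmono : ∫ x, φ x ^ 2 ≤ ∫ x, (2⁻¹ * φ x ^ 2 + 2 * R ^ 2 * ‖gradient φ x‖ ^ 2) := by
    have : ∫ x, φ x ^ 2 = ∫ x, -(x i * (φ x * fderiv ℝ φ x e + φ x * fderiv ℝ φ x e)) := by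
      rw [integral_neg, ibp, neg_neg]; simp [pow_two]
    rw [this]
    refine integral_mono ?_ ((hI.const_mul _).add (hG.const_mul _)) hpt
    refine Continuous.integrable_of_hasCompactSupport (by fun_prop) ?_
    refine h2.mono fun x hx => ?_
    rw [Function.mem_support] at hx ⊢
    intro h; exact hx (by simp [h])
  rw [integral_add (hI.const_mul _) (hG.const_mul _), integral_const_mul, integral_const_mul]
    at hmono
  linarith

/-- The Poincaré inequality on the closure of the test pairs. -/
lemma exists_poincare [NeZero d] (Ω : BoundedOpen d) :
    ∃ C : ℝ, 0 ≤ C ∧ ∀ p ∈ (testPairs Ω).topologicalClosure, ‖p.1‖ ≤ C * ‖p.2‖ := by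
  obtain ⟨R, hR0, hR⟩ := Ω.isBounded.exists_pos_norm_le
  refine ⟨2 * R, by positivity, fun p hp => ?_⟩
  have hcl : IsClosed {p : L2 Ω × L2Vec Ω | ‖p.1‖ ≤ 2 * R * ‖p.2‖} :=
    isClosed_le (by fun_prop) (by fun_prop)
  refine hcl.closure_subset_iff.2 ?_ hp
  rintro q ⟨φ, h1, h2, h3, h4, h5⟩
  have hP := poincare_test h1 h2 fun x hx => hR x (h3 hx)
  have n1 : ‖q.1‖ ^ 2 = ∫ x, φ x ^ 2 := by
    rw [← real_inner_self_eq_norm_sq, L2.inner_def,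
      ← setIntegral_eq_integral_of_forall_compl_eq_zero (s := Ω.carrier) (f := fun x => φ x ^ 2)]
    · refine integral_congr_ae ?_
      filter_upwards [h4] with x hx
      rw [hx]; simp [pow_two]
    · intro x hx
      rw [image_eq_zero_of_notMem_tsupport fun h => hx (h3 h)]; simp
  have n2 : ‖q.2‖ ^ 2 = ∫ x, ‖gradient φ x‖ ^ 2 := by
    rw [← real_inner_self_eq_norm_sq, L2.inner_def,
      ← setIntegral_eq_integral_of_forall_compl_eq_zero (s := Ω.carrier)
        (f := fun x => ‖gradient φ x‖ ^ 2)]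
    · refine integral_congr_ae ?_
      filter_upwards [h5] with x hx
      rw [hx, real_inner_self_eq_norm_sq]
    · intro x hx
      have : fderiv ℝ φ x = 0 := image_eq_zero_of_notMem_tsupport fun h =>
        hx (h3 (tsupport_fderiv_subset ℝ h))
      simp [gradient, this]
  rw [← n1, ← n2, ← mul_pow] at hP
  exact (sq_le_sq₀ (norm_nonneg _) (by positivity)).1 hP

/-- The Sobolev space `H₀¹(Ω)`: the closure of `C_c^∞(Ω)` in `H¹(Ω)`, an element being stored as
the pair of the function and its gradient. -/
def H01 (Ω : BoundedOpen d) : Type := (testPairs Ω).topologicalClosure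

instance (Ω : BoundedOpen d) : AddCommGroup (H01 Ω) :=
  inferInstanceAs (AddCommGroup (testPairs Ω).topologicalClosure)

instance (Ω : BoundedOpen d) : Module ℝ (H01 Ω) :=
  inferInstanceAs (Module ℝ (testPairs Ω).topologicalClosure)

/-- The function in `L²(Ω)` underlying an element of `H₀¹(Ω)`. -/
def H01.fn {Ω : BoundedOpen d} : H01 Ω →ₗ[ℝ] L2 Ω :=
  (LinearMap.fst ℝ (L2 Ω) (L2Vec Ω)).comp (testPairs Ω).topologicalClosure.subtype

/-- The gradient of an element of `H₀¹(Ω)`. -/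
def H01.grad {Ω : BoundedOpen d} : H01 Ω →ₗ[ℝ] L2Vec Ω :=
  (LinearMap.snd ℝ (L2 Ω) (L2Vec Ω)).comp (testPairs Ω).topologicalClosure.subtype

lemma H01.norm_fn_le_grad [NeZero d] (Ω : BoundedOpen d) :
    ∃ C : ℝ, 0 ≤ C ∧ ∀ z : H01 Ω, ‖H01.fn z‖ ≤ C * ‖H01.grad z‖ := by
  obtain ⟨C, hC, h⟩ := exists_poincare Ω
  exact ⟨C, hC, fun z => h z.1 z.2⟩

lemma H01.grad_injective [NeZero d] (Ω : BoundedOpen d) :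
    Function.Injective (H01.grad (Ω := Ω)) := by
  obtain ⟨C, hC, h⟩ := H01.norm_fn_le_grad Ω
  rw [injective_iff_map_eq_zero]
  intro z hz
  have h1 : H01.fn z = 0 := by simpa [hz] using h z
  exact Subtype.ext (Prod.ext h1 hz)

/-- The norm `‖z‖ = ‖∇z‖_{L²}`. -/
instance [NeZero d] (Ω : BoundedOpen d) : NormedAddCommGroup (H01 Ω) :=
  NormedAddCommGroup.induced (H01 Ω) (L2Vec Ω) H01.grad (H01.grad_injective Ω)

/-- The inner product `⟪z, w⟫ = ∫ ∇z · ∇w`. -/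
instance [NeZero d] (Ω : BoundedOpen d) : InnerProductSpace ℝ (H01 Ω) where
  norm_smul_le c z := by
    show ‖H01.grad (c • z)‖ ≤ ‖c‖ * ‖H01.grad z‖
    rw [map_smul, norm_smul]
  inner z w := inner ℝ (H01.grad z) (H01.grad w)
  norm_sq_eq_re_inner z := norm_sq_eq_re_inner (𝕜 := ℝ) (H01.grad z)
  conj_inner_symm z w := inner_conj_symm (𝕜 := ℝ) (H01.grad z) (H01.grad w)
  add_left z z' w := by rw [map_add, inner_add_left]
  smul_left z w c := by rw [map_smul, inner_smul_left]

lemma H01.norm_eq [NeZero d] {Ω : BoundedOpen d} (z : H01 Ω) : ‖z‖ = ‖H01.grad z‖ := rfl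

/-- The embedding `H₀¹(Ω) → L²(Ω)`. -/
def H01.toL2 [NeZero d] {Ω : BoundedOpen d} : H01 Ω →L[ℝ] L2 Ω :=
  H01.fn.mkContinuousOfExistsBound <| by
    obtain ⟨C, -, h⟩ := H01.norm_fn_le_grad Ω
    exact ⟨C, h⟩

instance [NeZero d] (Ω : BoundedOpen d) : CompleteSpace (H01 Ω) := by
  obtain ⟨C, hC, h⟩ := H01.norm_fn_le_grad Ω
  let S := (testPairs Ω).topologicalClosure
  have : CompleteSpace S := (testPairs Ω).isClosed_topologicalClosure.completeSpace_coe
  let e : S ≃ₗ[ℝ] H01 Ω := LinearEquiv.refl ℝ S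
  let E : S ≃L[ℝ] H01 Ω := e.toContinuousLinearEquivOfBounds 1 (max C 1)
    (fun z => by rw [one_mul]; exact norm_snd_le z.1)
    (fun z => by
      refine max_le ((h z).trans ?_) ?_
      · exact mul_le_mul_of_nonneg_right (le_max_left _ _) (norm_nonneg _)
      · calc _ = 1 * ‖z‖ := (one_mul _).symm
          _ ≤ _ := mul_le_mul_of_nonneg_right (le_max_right _ _) (norm_nonneg _))
  exact (completeSpace_congr (e := E.toEquiv) E.isUniformEmbedding).1 this

section StateEquation
variable [NeZero d] {Ω : BoundedOpen d} {T : ℝ}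

/-- The distributional Laplacian `Δ : H₀¹(Ω) → H⁻¹(Ω)`, `⟨Δz, w⟩ = -∫ ∇z · ∇w`. -/
def laplacian (z : H01 Ω) : StrongDual ℝ (H01 Ω) := -innerSL ℝ z

/-- The embedding `L²(Ω) → H⁻¹(Ω)`, `⟨f, w⟩ = ∫ f w`. -/
def toHneg (f : L2 Ω) : StrongDual ℝ (H01 Ω) := (innerSL ℝ f).comp H01.toL2

/-- The dissipation `D(v) = ∫ |v|` on `H₀¹(Ω)`. -/
def dissipation (v : H01 Ω) : ℝ := ∫ x in Ω.carrier, |H01.toL2 v x|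

/-- The set of controls `g ∈ H¹(I; L²(Ω))` with `‖g(0)‖_{L^∞(Ω)} ≤ 1`. -/
def compatibleControls (Ω : BoundedOpen d) (T : ℝ) : Set (H1 (L2 Ω) T) :=
  {g | ∀ᵐ x ∂Ω.measure, |H1.rep g 0 x| ≤ 1}

/-- `z ∈ H¹_⋆(I; H₀¹(Ω))` solves `0 ∈ ∂|ż| - Δz - g` in `H⁻¹(Ω)`, a.e. in `I`. -/
def IsSolution (g : H1 (L2 Ω) T) (z : H1Star (H01 Ω) T) : Prop :=
  ∀ᵐ t ∂timeMeasure T, ∃ ξ ∈ subdifferential dissipation (H1.der z.1 t),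
    0 = ξ - laplacian (H1.val z.1 t) - toHneg (H1.val g t)

/-- The family `|·|_ρ`, `ρ > 0`, consists of convex even `C^{2,1}` functions which agree with the
modulus outside `(-ρ, ρ)` and have second derivative at most `2 / ρ`. -/
structure IsRegularizedAbs (r : ℝ → ℝ → ℝ) : Prop where
  contDiff : ∀ ρ > 0, ContDiff ℝ 2 (r ρ)
  lipschitz : ∀ ρ > 0, ∃ L, LipschitzWith L (deriv (deriv (r ρ)))
  convex : ∀ ρ > 0, ConvexOn ℝ univ (r ρ)
  even : ∀ ρ > 0, ∀ v, r ρ (-v) = r ρ v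
  eq_abs : ∀ ρ > 0, ∀ v, ρ ≤ |v| → r ρ v = |v|
  deriv2_le : ∀ ρ > 0, ∀ v, deriv (deriv (r ρ)) v ≤ 2 / ρ

/-- `z ∈ H¹_⋆(I; H₀¹(Ω))` solves `|ż|_ρ' - ρ Δż - Δz = g` in `H⁻¹(Ω)`, a.e. in `I`. -/
def IsRegSolution (r : ℝ → ℝ → ℝ) (ρ : ℝ) (g : H1 (L2 Ω) T) (z : H1Star (H01 Ω) T) : Prop :=
  ∀ᵐ t ∂timeMeasure T, ∀ w : H01 Ω,
    (∫ x in Ω.carrier, deriv (r ρ) (H01.toL2 (H1.der z.1 t) x) * H01.toL2 w x)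
      - ρ * laplacian (H1.der z.1 t) w - laplacian (H1.val z.1 t) w = toHneg (H1.val g t) w

open Classical in
/-- The solution operator `S` of the state equation (with value `0` if there is no solution). -/
def solOp (g : H1 (L2 Ω) T) : H1Star (H01 Ω) T :=
  if h : ∃ z, IsSolution g z then h.choose else 0

open Classical in
/-- The solution operator `S_ρ` of the regularized state equation (with value `0` if there is no
solution). -/
def regSolOp (r : ℝ → ℝ → ℝ) (ρ : ℝ) (g : H1 (L2 Ω) T) : H1Star (H01 Ω) T :=
  if h : ∃ z, IsRegSolution r ρ g z then h.choose else 0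

end StateEquation

end Domain

end

/-!
The state equations are evolutions in the Hilbert space `V = H₀¹(Ω)`. By the Riesz isomorphism a
control `g` becomes `ℓ = ι* g` with `ι : V → L²(Ω)` the embedding, the inclusion reads
`ℓ - z ∈ ∂D(ż)`, and its regularization reads `Φ_ρ(ż) + ρ ż + z = ℓ`, where `Φ_ρ` is the gradient
of `D_ρ(v) = ∫ |v|_ρ`. The properties of `|·|_ρ` that matter are `D ≤ D_ρ ≤ D + ρ |Ω|` and
`⟪Φ_ρ(v), w⟫ ≤ D(w)`; they are collected in `IsSmoothing`. The unknown is `ż ∈ L²(I; V)`, which is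
identified with `z ∈ H¹_⋆(I; V)` by `primitiveH1`.

* The regularized equation is uniquely solvable because `u ↦ Φ_ρ(u) + ρ u + ∫₀ᵗ u` is Lipschitz and
  strongly monotone on `L²(I; V)` (`IsSmoothing.existsUnique`).
* For compatible data `‖ż‖² ≤ ‖ℓ'‖² + 2 ρ |Ω|` (`IsSmoothing.norm_sq_le`). This is the energy balance
  for the convex conjugate of `D_ρ + ρ/2 ‖·‖²` along `ℓ - z`; as the velocity is only continuous, it
  is derived from a one-sided chain rule for subgradients (`sub_le_integral_inner`).
* Both equations imply a variational inequality with an error of order `ρ` (`IsApproxSolution`).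
  Testing two such inequalities with the velocity of the other solution gives
  `½ ‖z₁ - z₂‖² ≤ ‖ℓ₁ - ℓ₂‖ ‖ż₁ - ż₂‖ + ρ₁/4 ‖ż₂‖² + ρ₂/4 ‖ż₁‖² + (ρ₁ + ρ₂) |Ω| T`
  (`IsApproxSolution.norm_sub_sq_le`). This estimate yields uniqueness, the rate `ρ^(1/2)`, and, with
  the energy estimate, that regularized solutions form a Cauchy sequence as `ρ → 0`. Their limit
  solves the inclusion (`exists_isApproxSolution_zero`).
* For weakly convergent controls the estimate applies because the data converge strongly in
  `L²(I; V)`: the controls converge weakly at each time, and `ι*` is compact by Rellich's theorem,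
  which is proved by comparing functions with their averages over small balls
  (`tendsto_toL2_of_tendsto_weakly`).
-/

noncomputable section

/-! ### Monotone operators and weak compactness in Hilbert spaces -/

section Hilbert
variable {E : Type*} [NormedAddCommGroup E] [InnerProductSpace ℝ E] [CompleteSpace E]

/-- Zarantonello's theorem: a Lipschitz, strongly monotone operator on a Hilbert space is onto.
For `τ` small, `x ↦ x - τ (A x - f)` is a contraction. -/
theorem exists_eq_of_strongMonotone {A : E → E} {K : NNReal} (hK : LipschitzWith K A) {c : ℝ}
    (hc : 0 < c) (hm : ∀ x y, c * ‖x - y‖ ^ 2 ≤ inner ℝ (A x - A y) (x - y)) (f : E) :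
    ∃ x, A x = f := by
  -- `τ = c / M²` minimizes `1 - 2 τ c + τ² M²`, the square of the contraction constant.
  set M : ℝ := K + c with hM
  have hM0 : 0 < M := by positivity
  have hcM : c ≤ M := by rw [hM]; simp
  set τ : ℝ := c / M ^ 2 with hτ
  have hτ0 : 0 < τ := by positivity
  set q : ℝ := 1 - c ^ 2 / M ^ 2 with hq
  have hq1 : q < 1 := by
    have : 0 < c ^ 2 / M ^ 2 := by positivity
    rw [hq]; linarith
  have hq0 : 0 ≤ q := by
    rw [hq, sub_nonneg, div_le_one (by positivity)]; gcongr
  have hcontr : ContractingWith (Real.sqrt q).toNNReal (fun x => x - τ • (A x - f)) := by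
    refine ⟨?_, LipschitzWith.of_dist_le_mul fun x y => ?_⟩
    · rw [← NNReal.coe_lt_coe, Real.coe_toNNReal _ (Real.sqrt_nonneg _), NNReal.coe_one,
        Real.sqrt_lt' one_pos]
      simpa using hq1
    rw [Real.coe_toNNReal _ (Real.sqrt_nonneg _), dist_eq_norm, dist_eq_norm]
    have e : x - τ • (A x - f) - (y - τ • (A y - f)) = (x - y) - τ • (A x - A y) := by
      module
    have h1 : ‖A x - A y‖ ≤ M * ‖x - y‖ := by
      have := hK.dist_le_mul x y
      rw [dist_eq_norm, dist_eq_norm] at this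
      refine this.trans ?_
      gcongr
      rw [hM]; linarith
    have h2 : ‖A x - A y‖ ^ 2 ≤ M ^ 2 * ‖x - y‖ ^ 2 := by
      rw [← mul_pow]; gcongr
    refine (sq_le_sq₀ (norm_nonneg _) (by positivity)).1 ?_
    rw [e, norm_sub_sq_real, inner_smul_right, norm_smul, mul_pow, mul_pow, Real.sq_sqrt hq0,
      Real.norm_of_nonneg hτ0.le, real_inner_comm]
    have h3 := mul_le_mul_of_nonneg_left (hm x y) hτ0.le
    have h4 := mul_le_mul_of_nonneg_left h2 (sq_nonneg τ)
    have e1 : τ * c = c ^ 2 / M ^ 2 := by rw [hτ]; ring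
    have e2 : τ ^ 2 * M ^ 2 = c ^ 2 / M ^ 2 := by rw [hτ]; field_simp
    have e3 : τ * (c * ‖x - y‖ ^ 2) = c ^ 2 / M ^ 2 * ‖x - y‖ ^ 2 := by rw [← mul_assoc, e1]
    have e4 : τ ^ 2 * (M ^ 2 * ‖x - y‖ ^ 2) = c ^ 2 / M ^ 2 * ‖x - y‖ ^ 2 := by
      rw [← mul_assoc, e2]
    rw [hq]
    nlinarith
  have hfix := hcontr.fixedPoint_isFixedPt
  set x := hcontr.fixedPoint
  refine ⟨x, ?_⟩
  have h5 : τ • (A x - f) = 0 := by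
    have h6 : x - τ • (A x - f) = x := hfix
    simpa using h6
  exact sub_eq_zero.1 ((smul_eq_zero.1 h5).resolve_left hτ0.ne')

/-- A bounded sequence of a Hilbert space whose images under an injective continuous linear map
converge has a weak limit. Along each ultrafilter there is a weak limit by the Banach-Alaoglu
theorem, and the map identifies it. -/
theorem exists_tendsto_inner_of_bounded {F : Type*} [NormedAddCommGroup F] [NormedSpace ℝ F]
    (T : E →L[ℝ] F) (hT : Function.Injective T) {x : ℕ → E} {C : ℝ} (hC : ∀ n, ‖x n‖ ≤ C) {y : F}
    (hy : Tendsto (fun n => T (x n)) atTop (𝓝 y)) :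
    ∃ a, T a = y ∧ ∀ e, Tendsto (fun n => inner ℝ e (x n)) atTop (𝓝 (inner ℝ e a)) := by
  have key : ∀ U : Ultrafilter ℕ, (U : Filter ℕ) ≤ atTop →
      ∃ a, T a = y ∧ ∀ e, Tendsto (fun n => inner ℝ e (x n)) U (𝓝 (inner ℝ e a)) := by
    intro U hU
    have hcomp := WeakDual.isCompact_closedBall (0 : StrongDual ℝ E) C
    let ψ : ℕ → WeakDual ℝ E := fun n => StrongDual.toWeakDual (innerSL ℝ (x n))
    obtain ⟨ξ, -, hξ⟩ := hcomp.ultrafilter_le_nhds (U.map ψ) (by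
      rw [Filter.le_principal_iff, Ultrafilter.mem_coe, Ultrafilter.mem_map, ← Ultrafilter.mem_coe]
      refine Filter.mem_of_superset univ_mem fun n _ => ?_
      have h0 : innerSL ℝ (x n) ∈ Metric.closedBall (0 : StrongDual ℝ E) C := by
        simpa using hC n
      exact h0)
    have hξ' : Tendsto ψ U (𝓝 ξ) := hξ
    let a : E := (InnerProductSpace.toDual ℝ E).symm (WeakDual.toStrongDual ξ)
    have ha : ∀ e, inner ℝ e a = ξ e := fun e => by
      rw [real_inner_comm]
      exact InnerProductSpace.toDual_symm_apply
    have hlim : ∀ e, Tendsto (fun n => inner ℝ e (x n)) U (𝓝 (inner ℝ e a)) := fun e => by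
      have h1 := ((WeakDual.eval_continuous (𝕜 := ℝ) e).tendsto ξ).comp hξ'
      rw [ha]
      refine h1.congr fun n => ?_
      simpa [ψ] using real_inner_comm e (x n)
    refine ⟨a, ?_, hlim⟩
    rw [SeparatingDual.eq_iff_forall_dual_eq (R := ℝ)]
    intro f
    have h1 : Tendsto (fun n => f (T (x n))) U (𝓝 (f y)) :=
      ((f.continuous.tendsto y).comp hy).mono_left hU
    have h2 := hlim ((InnerProductSpace.toDual ℝ E).symm (f.comp T))
    simp only [InnerProductSpace.toDual_symm_apply, ContinuousLinearMap.comp_apply] at h2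
    exact tendsto_nhds_unique h2 h1
  obtain ⟨a, ha, -⟩ := key (hyperfilter ℕ) Nat.hyperfilter_le_atTop
  refine ⟨a, ha, fun e => ?_⟩
  rw [tendsto_iff_ultrafilter]
  intro U hU
  obtain ⟨a', ha', h'⟩ := key U hU
  rw [← hT (ha'.trans ha.symm)]
  exact h' e

end Hilbert

theorem TendstoWeakly.exists_norm_le {E : Type*} [NormedAddCommGroup E] [NormedSpace ℝ E]
    {x : ℕ → E} {a : E} (h : TendstoWeakly x a) : ∃ C, ∀ n, ‖x n‖ ≤ C := by
  obtain ⟨C, hC⟩ := banach_steinhaus (g := fun n => NormedSpace.inclusionInDoubleDual ℝ E (x n))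
    (fun ℓ => by
      obtain ⟨C, hC⟩ := (h ℓ).norm.bddAbove_range
      exact ⟨C, fun n => hC ⟨n, rfl⟩⟩)
  refine ⟨C, fun n => ?_⟩
  rw [← (NormedSpace.inclusionInDoubleDualLi (E := E) ℝ).norm_map (x n)]
  exact hC n

/-! ### Primitives and the Bochner-Sobolev space -/

section Time
variable {X : Type*} [NormedAddCommGroup X] {T : ℝ}

theorem Lp.norm_sq_eq_integral_norm_sq {α F : Type*} [MeasurableSpace α] {μ : Measure α}
    [NormedAddCommGroup F] [InnerProductSpace ℝ F] (u : Lp F 2 μ) :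
    ‖u‖ ^ 2 = ∫ x, ‖u x‖ ^ 2 ∂μ := by
  rw [← real_inner_self_eq_norm_sq, L2.inner_def]
  simp only [real_inner_self_eq_norm_sq]

theorem Lp.integrable_norm_sq {α F : Type*} [MeasurableSpace α] {μ : Measure α}
    [NormedAddCommGroup F] (u : Lp F 2 μ) : Integrable (fun x => ‖u x‖ ^ 2) μ :=
  (memLp_two_iff_integrable_sq_norm (Lp.aestronglyMeasurable u)).1 (Lp.memLp u)

theorem intervalIntegrable_Lp_time (u : Lp X 2 (timeMeasure T)) {s t : ℝ} (hs : s ∈ Icc 0 T)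
    (ht : t ∈ Icc 0 T) : IntervalIntegrable u volume s t := by
  have h : IntervalIntegrable u volume 0 T := by
    rw [intervalIntegrable_iff_integrableOn_Ioo_of_le (hs.1.trans hs.2)]
    exact integrable_Lp_time u
  refine h.mono_set ?_
  rw [uIcc_of_le (hs.1.trans hs.2)]
  exact uIcc_subset_Icc hs ht

theorem memLp_of_continuousOn {f : ℝ → X} (hf : ContinuousOn f (Icc 0 T)) :
    MemLp f 2 (timeMeasure T) := by
  obtain ⟨M, hM⟩ := isCompact_Icc.exists_bound_of_continuousOn hf
  refine MemLp.of_bound ?_ M ?_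
  · exact (hf.mono Ioo_subset_Icc_self).aestronglyMeasurable measurableSet_Ioo
  · filter_upwards [ae_restrict_mem measurableSet_Ioo] with t ht
    exact hM t (Ioo_subset_Icc_self ht)

theorem integral_norm_mul_norm_le {α : Type*} [MeasurableSpace α] {μ : Measure α}
    (f g : Lp X 2 μ) : ∫ t, ‖f t‖ * ‖g t‖ ∂μ ≤ ‖f‖ * ‖g‖ := by
  have hf := (Lp.memLp f).norm
  have hg := (Lp.memLp g).norm
  have h1 := real_inner_le_norm (hf.toLp _) (hg.toLp _)
  rw [Lp.norm_toLp, Lp.norm_toLp, eLpNorm_norm, eLpNorm_norm, ← Lp.norm_def, ← Lp.norm_def,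
    L2.inner_def] at h1
  refine le_trans (le_of_eq (integral_congr_ae ?_)) h1
  filter_upwards [hf.coeFn_toLp, hg.coeFn_toLp] with t h1 h2
  rw [h1, h2]
  simp [mul_comm]

theorem integral_norm_le_sqrt_mul_norm {α : Type*} [MeasurableSpace α] {μ : Measure α}
    [IsFiniteMeasure μ] (f : Lp X 2 μ) : ∫ t, ‖f t‖ ∂μ ≤ Real.sqrt (μ.real univ) * ‖f‖ := by
  have hf := (Lp.memLp f).norm
  have h1 := real_inner_le_norm (Lp.const 2 μ (1 : ℝ)) (hf.toLp _)
  have h2 : ‖Lp.const 2 μ (1 : ℝ)‖ ≤ Real.sqrt (μ.real univ) := by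
    refine (Lp.norm_const_le (p := 2) (μ := μ) (c := (1 : ℝ))).trans (le_of_eq ?_)
    rw [norm_one, one_mul, Real.sqrt_eq_rpow]
    norm_num
  rw [Lp.norm_toLp, eLpNorm_norm, ← Lp.norm_def, L2.inner_def] at h1
  refine (le_of_eq (integral_congr_ae ?_)).trans (h1.trans (by gcongr))
  filter_upwards [hf.coeFn_toLp, Lp.coeFn_const 2 μ (1 : ℝ)] with t h1 h2
  rw [h1, h2]
  simp

variable [InnerProductSpace ℝ X]

/-- The primitive `t ↦ ∫₀ᵗ u` of `u ∈ L²(I; X)`. -/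
def primitive (u : Lp X 2 (timeMeasure T)) (t : ℝ) : X := ∫ s in (0 : ℝ)..t, u s

@[simp] theorem primitive_zero_right (u : Lp X 2 (timeMeasure T)) : primitive u 0 = 0 := by
  simp [primitive]

theorem primitive_sub_eq_integral (u : Lp X 2 (timeMeasure T)) {s t : ℝ} (hs : s ∈ Icc 0 T)
    (ht : t ∈ Icc 0 T) : primitive u t - primitive u s = ∫ τ in s..t, u τ := by
  have h0 : (0 : ℝ) ∈ Icc 0 T := ⟨le_rfl, hs.1.trans hs.2⟩
  exact intervalIntegral.integral_interval_sub_left (intervalIntegrable_Lp_time u h0 ht)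
    (intervalIntegrable_Lp_time u h0 hs)

theorem ae_timeMeasure_restrict_uIoc {p : ℝ → Prop} (h : ∀ᵐ s ∂timeMeasure T, p s) {a t : ℝ}
    (ha : a ∈ Icc 0 T) (ht : t ∈ Icc 0 T) : ∀ᵐ s, s ∈ uIoc a t → p s := by
  rw [timeMeasure, restrict_Ioo_eq_restrict_Icc, ae_restrict_iff' measurableSet_Icc] at h
  filter_upwards [h] with s hs hst
  exact hs (uIcc_subset_Icc ha ht (uIoc_subset_uIcc hst))

theorem primitive_add {t : ℝ} (ht : t ∈ Icc 0 T) (u v : Lp X 2 (timeMeasure T)) :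
    primitive (u + v) t = primitive u t + primitive v t := by
  have h0 : (0 : ℝ) ∈ Icc 0 T := ⟨le_rfl, ht.1.trans ht.2⟩
  rw [primitive, primitive, primitive, ← intervalIntegral.integral_add
    (intervalIntegrable_Lp_time u h0 ht) (intervalIntegrable_Lp_time v h0 ht)]
  exact intervalIntegral.integral_congr_ae
    (ae_timeMeasure_restrict_uIoc (Lp.coeFn_add u v) h0 ht)

theorem primitive_smul {t : ℝ} (ht : t ∈ Icc 0 T) (c : ℝ) (u : Lp X 2 (timeMeasure T)) :
    primitive (c • u) t = c • primitive u t := by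
  have h0 : (0 : ℝ) ∈ Icc 0 T := ⟨le_rfl, ht.1.trans ht.2⟩
  rw [primitive, primitive, ← intervalIntegral.integral_smul]
  exact intervalIntegral.integral_congr_ae
    (ae_timeMeasure_restrict_uIoc (Lp.coeFn_smul c u) h0 ht)

theorem primitive_sub {t : ℝ} (ht : t ∈ Icc 0 T) (u v : Lp X 2 (timeMeasure T)) :
    primitive (u - v) t = primitive u t - primitive v t := by
  rw [eq_sub_iff_add_eq, ← primitive_add ht, sub_add_cancel]

theorem continuousOn_primitive (u : Lp X 2 (timeMeasure T)) :
    ContinuousOn (primitive u) (Icc 0 T) := by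
  rcases le_or_gt T 0 with hT | hT
  · exact (Set.subsingleton_Icc_of_ge hT).continuousOn _
  have h0 : (0 : ℝ) ∈ Icc 0 T := ⟨le_rfl, hT.le⟩
  have h1 : T ∈ Icc 0 T := ⟨hT.le, le_rfl⟩
  exact (intervalIntegral.continuousOn_primitive_interval' (intervalIntegrable_Lp_time u h0 h1)
    (by simp [hT.le])).mono (by rw [uIcc_of_le hT.le])

theorem norm_primitive_le (u : Lp X 2 (timeMeasure T)) {t : ℝ} (ht : t ∈ Icc 0 T) :
    ‖primitive u t‖ ≤ Real.sqrt ((timeMeasure T).real univ) * ‖u‖ := by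
  refine le_trans ?_ (integral_norm_le_sqrt_mul_norm u)
  rw [← integral_Ioc_eq_integral_Ioo]
  refine (intervalIntegral.norm_integral_le_integral_norm ht.1).trans ?_
  rw [intervalIntegral.integral_of_le ht.1]
  refine setIntegral_mono_set ?_ (Eventually.of_forall fun _ => norm_nonneg _)
    (Ioc_subset_Ioc_right ht.2).eventuallyLE
  exact (integrableOn_Ioc_iff_integrableOn_Ioo (by simp)).2 (integrable_Lp_time u).norm

variable (X T) in
/-- The primitive as an operator on `L²(I; X)`. -/
def primitiveL2 : Lp X 2 (timeMeasure T) →L[ℝ] Lp X 2 (timeMeasure T) :=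
  LinearMap.mkContinuous
    { toFun := fun u => (memLp_of_continuousOn (continuousOn_primitive u)).toLp _
      map_add' := fun u v => by
        rw [← MemLp.toLp_add, MemLp.toLp_eq_toLp_iff]
        filter_upwards [ae_restrict_mem measurableSet_Ioo] with t ht
        exact primitive_add (Ioo_subset_Icc_self ht) u v
      map_smul' := fun c u => by
        rw [RingHom.id_apply, ← MemLp.toLp_const_smul, MemLp.toLp_eq_toLp_iff]
        filter_upwards [ae_restrict_mem measurableSet_Ioo] with t ht
        exact primitive_smul (Ioo_subset_Icc_self ht) c u }
    ((measureUnivNNReal (timeMeasure T) : ℝ) ^ (2 : ENNReal).toReal⁻¹ *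
      Real.sqrt ((timeMeasure T).real univ)) fun u => by
      rw [mul_assoc]
      refine Lp.norm_le_of_ae_bound (by positivity) ?_
      filter_upwards [MemLp.coeFn_toLp (memLp_of_continuousOn (continuousOn_primitive u)),
        ae_restrict_mem measurableSet_Ioo] with t ht ht'
      exact (congrArg norm ht).trans_le (norm_primitive_le u (Ioo_subset_Icc_self ht'))

theorem coeFn_primitiveL2 (u : Lp X 2 (timeMeasure T)) :
    primitiveL2 X T u =ᵐ[timeMeasure T] primitive u :=
  MemLp.coeFn_toLp (memLp_of_continuousOn (continuousOn_primitive u))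

variable (X T) in
/-- The primitive as an operator from `L²(I; X)` to `C([0, T]; X)`. -/
def primitiveC : Lp X 2 (timeMeasure T) →L[ℝ] C(Icc (0 : ℝ) T, X) :=
  LinearMap.mkContinuous
    { toFun := fun u => ⟨(Icc 0 T).domRestrict (primitive u),
        (continuousOn_primitive u).domRestrict⟩
      map_add' := fun u v => ContinuousMap.ext fun t => primitive_add t.2 u v
      map_smul' := fun c u => ContinuousMap.ext fun t => primitive_smul t.2 c u }
    (Real.sqrt ((timeMeasure T).real univ)) fun u => by
      rw [ContinuousMap.norm_le _ (by positivity)]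
      exact fun t => norm_primitive_le u t.2

theorem IsWeakDeriv.congr_left {u u' v : ℝ → X} (h : IsWeakDeriv T u v)
    (hu : u' =ᵐ[timeMeasure T] u) : IsWeakDeriv T u' v := by
  intro φ h1 h2 h3
  rw [← h φ h1 h2 h3]
  refine integral_congr_ae ?_
  filter_upwards [hu] with t ht
  rw [ht]

theorem H1.norm_der_le (u : H1 X T) : ‖H1.der u‖ ≤ ‖u‖ := WithLp.norm_snd_le _ u.1

theorem IsWeakDeriv.congr_right {u v v' : ℝ → X} (h : IsWeakDeriv T u v)
    (hv : v' =ᵐ[timeMeasure T] v) : IsWeakDeriv T u v' := by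
  intro φ h1 h2 h3
  rw [h φ h1 h2 h3]
  congr 1
  refine integral_congr_ae ?_
  filter_upwards [hv] with t ht
  rw [ht]

variable [CompleteSpace X]

theorem isWeakDeriv_primitive (u : Lp X 2 (timeMeasure T)) : IsWeakDeriv T (primitive u) u :=
  fun _ h1 _ h3 => integral_deriv_smul_primitive h1 h3 (integrable_Lp_time u)

theorem IsWeakDeriv.ae_unique {u v v' : ℝ → X} (hv : Integrable v (timeMeasure T))
    (hv' : Integrable v' (timeMeasure T)) (h : IsWeakDeriv T u v) (h' : IsWeakDeriv T u v') :
    v =ᵐ[timeMeasure T] v' := by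
  have main : ∀ᵐ t ∂(volume : Measure ℝ), t ∈ Ioo 0 T → v t - v' t = 0 := by
    refine isOpen_Ioo.ae_eq_zero_of_integral_contDiff_smul_eq_zero
      (IntegrableOn.locallyIntegrableOn (hv.sub hv')) ?_
    intro φ h1 h2 h3
    have e : ∫ t, φ t • (v t - v' t) = ∫ t in Ioo 0 T, φ t • (v t - v' t) :=
      (setIntegral_eq_integral_of_forall_compl_eq_zero fun t ht => by
        rw [image_eq_zero_of_notMem_tsupport fun hh => ht (h3 hh), zero_smul]).symm
    rw [e]
    simp only [smul_sub]
    rw [integral_sub (integrable_smul_test h1.continuous hv)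
      (integrable_smul_test h1.continuous hv'), sub_eq_zero, ← neg_inj,
      ← h φ h1 h2 h3, ← h' φ h1 h2 h3]
  rw [timeMeasure, Filter.EventuallyEq, ae_restrict_iff' measurableSet_Ioo]
  filter_upwards [main] with t ht hmem
  exact sub_eq_zero.1 (ht hmem)

/-- An element of `H¹(I; X)` is determined by its underlying function. -/
theorem H1.ext_val {u v : H1 X T} (h : H1.val u = H1.val v) : u = v := by
  have h1 : H1.der u = H1.der v := Lp.ext <| IsWeakDeriv.ae_unique
    (integrable_Lp_time _) (integrable_Lp_time _) u.2 (by
      have h2 : IsWeakDeriv T (H1.val v) (H1.der v) := v.2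
      rw [← h] at h2
      exact h2)
  exact Subtype.ext ((WithLp.equiv 2 _).injective (Prod.ext h h1))

theorem eq_zero_of_primitive_eq_zero {u : Lp X 2 (timeMeasure T)}
    (h : ∀ t ∈ Icc 0 T, primitive u t = 0) : u = 0 := by
  have h1 : IsWeakDeriv T (0 : ℝ → X) u := (isWeakDeriv_primitive u).congr_left <| by
    filter_upwards [ae_restrict_mem measurableSet_Ioo] with t ht
    exact (h t (Ioo_subset_Icc_self ht)).symm
  have h2 : IsWeakDeriv T (0 : ℝ → X) (0 : ℝ → X) := fun φ _ _ _ => by simp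
  exact Lp.ext ((IsWeakDeriv.ae_unique (integrable_Lp_time u) (integrable_zero _ _ _) h1 h2).trans
    (Lp.coeFn_zero _ _ _).symm)

theorem primitiveC_injective : Function.Injective (primitiveC X T) := by
  rw [injective_iff_map_eq_zero]
  intro u hu
  exact eq_zero_of_primitive_eq_zero fun t ht =>
    congrArg (fun f : C(Icc (0 : ℝ) T, X) => f ⟨t, ht⟩) hu

variable (X T) in
/-- The primitive as an operator from `L²(I; X)` to `H¹_⋆(I; X)`. -/
def primitiveH1 : Lp X 2 (timeMeasure T) →L[ℝ] H1Star X T :=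
  ContinuousLinearMap.codRestrict
    (ContinuousLinearMap.codRestrict
      ((WithLp.prodContinuousLinearEquiv 2 ℝ _ _).symm.toContinuousLinearMap.comp
        ((primitiveL2 X T).prod (ContinuousLinearMap.id ℝ _))) (H1 X T) fun u =>
          (isWeakDeriv_primitive u).congr_left (coeFn_primitiveL2 u)) (H1Star X T) fun u =>
      ⟨primitive u, ⟨continuousOn_primitive u, coeFn_primitiveL2 u⟩, primitive_zero_right u⟩

@[simp] theorem der_primitiveH1 (u : Lp X 2 (timeMeasure T)) :
    H1.der (primitiveH1 X T u).1 = u := rfl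

theorem val_primitiveH1 (u : Lp X 2 (timeMeasure T)) :
    H1.val (primitiveH1 X T u).1 = primitiveL2 X T u := rfl

theorem isContRep_primitiveH1 (u : Lp X 2 (timeMeasure T)) :
    IsContRep (primitiveH1 X T u).1 (primitive u) :=
  ⟨continuousOn_primitive u, coeFn_primitiveL2 u⟩

theorem H1.rep_eq_add_primitive (hT : 0 < T) (u : H1 X T) {t : ℝ} (ht : t ∈ Icc 0 T) :
    H1.rep u t = H1.rep u 0 + primitive (H1.der u) t := by
  obtain ⟨c, hc⟩ := IsWeakDeriv.exists_eq_primitive (integrable_Lp_time (H1.val u))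
    (integrable_Lp_time (H1.der u)) u.2
  have h := (H1.isContRep_rep u).eqOn hT
    (f' := fun t => c + primitive (H1.der u) t)
    ⟨continuousOn_const.add (continuousOn_primitive _), hc⟩
  rw [h ht, h ⟨le_rfl, hT.le⟩]
  simp

theorem primitiveH1_der (hT : 0 < T) (z : H1Star X T) : primitiveH1 X T (H1.der z.1) = z := by
  refine Subtype.ext (H1.ext_val (Lp.ext ?_))
  rw [val_primitiveH1]
  refine (coeFn_primitiveL2 _).trans (Filter.EventuallyEq.trans ?_ (H1.isContRep_rep z.1).2.symm)
  filter_upwards [ae_restrict_mem measurableSet_Ioo] with t ht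
  rw [H1.rep_eq_add_primitive hT z.1 (Ioo_subset_Icc_self ht), (mem_H1Star_iff hT z.1).1 z.2,
    zero_add]

theorem toC_primitiveH1 (hT : 0 < T) (u : Lp X 2 (timeMeasure T)) :
    H1.toC (primitiveH1 X T u).1 = primitiveC X T u :=
  ContinuousMap.ext fun t => (H1.isContRep_rep _).eqOn hT (isContRep_primitiveH1 u) t.2

end Time

/-! ### A one-sided chain rule -/

section Chain
variable {X : Type*} [NormedAddCommGroup X] [InnerProductSpace ℝ X] {T : ℝ}

theorem integrable_real_inner_of_memLp {α : Type*} [MeasurableSpace α] {μ : Measure α}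
    {f g : α → X} (hf : MemLp f 2 μ) (hg : MemLp g 2 μ) :
    Integrable (fun x => inner ℝ (f x) (g x)) μ := by
  refine (L2.integrable_inner (𝕜 := ℝ) (hf.toLp f) (hg.toLp g)).congr ?_
  filter_upwards [hf.coeFn_toLp, hg.coeFn_toLp] with x h1 h2
  rw [h1, h2]

variable [CompleteSpace X]

/-- A one-sided chain rule along `q = primitive u`: if `b t` is a subgradient of `f` at time `t`,
in the sense that `f t - f s ≤ ⟪b t, q t - q s⟫` for `s ≤ t`, then `f t - f 0 ≤ ∫₀ᵗ ⟪b, q'⟫`. -/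
theorem sub_le_integral_inner {f : ℝ → ℝ} {b : ℝ → X} (hb : ContinuousOn b (Icc 0 T))
    (u : Lp X 2 (timeMeasure T))
    (hf : ∀ s ∈ Icc 0 T, ∀ t ∈ Icc 0 T, s ≤ t →
      f t - f s ≤ inner ℝ (b t) (primitive u t - primitive u s)) {t : ℝ} (ht : t ∈ Icc 0 T) :
    f t - f 0 ≤ ∫ s in (0 : ℝ)..t, inner ℝ (b s) (u s) := by
  have h0 : (0 : ℝ) ∈ Icc 0 T := ⟨le_rfl, ht.1.trans ht.2⟩
  have hint : ∀ r ∈ Icc 0 T, ∀ r' ∈ Icc 0 T,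
      IntervalIntegrable (fun s => (inner ℝ (b s) (u s) : ℝ)) volume r r' := by
    intro r hr r' hr'
    have h : IntervalIntegrable (fun s => (inner ℝ (b s) (u s) : ℝ)) volume 0 T := by
      rw [intervalIntegrable_iff_integrableOn_Ioo_of_le (hr.1.trans hr.2)]
      exact integrable_real_inner_of_memLp (memLp_of_continuousOn hb) (Lp.memLp u)
    refine h.mono_set ?_
    rw [uIcc_of_le (hr.1.trans hr.2)]
    exact uIcc_subset_Icc hr hr'
  set B := ∫ s in (0 : ℝ)..t, ‖u s‖
  have hB : 0 ≤ B := intervalIntegral.integral_nonneg ht.1 fun _ _ => norm_nonneg _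
  -- On an interval on which `b` oscillates by at most `ε`, replacing `b` by its value at the right
  -- end costs `ε ∫ ‖u‖`; a fine partition of `[0, t]` gives the estimate up to `ε B`.
  suffices H : ∀ ε > 0, f t - f 0 ≤ (∫ s in (0 : ℝ)..t, inner ℝ (b s) (u s)) + ε * B by
    refine le_of_forall_pos_le_add fun ε hε => (H (ε / (B + 1)) (by positivity)).trans ?_
    gcongr
    rw [div_mul_eq_mul_div, div_le_iff₀ (by positivity)]
    nlinarith
  intro ε hε
  have huc := isCompact_Icc.uniformContinuousOn_of_continuous hb
  obtain ⟨δ, hδ, hδ'⟩ := Metric.uniformContinuousOn_iff.1 huc ε hε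
  obtain ⟨N, hN⟩ := exists_nat_gt (t / δ)
  have hN0 : (0 : ℝ) < N := (div_nonneg ht.1 hδ.le).trans_lt hN
  have hmem : ∀ i : ℕ, i ≤ N → (i : ℝ) * (t / N) ∈ Icc 0 T := by
    intro i hi
    have h1 : (i : ℝ) ≤ N := by exact_mod_cast hi
    have h2 : 0 ≤ t / N := div_nonneg ht.1 hN0.le
    refine ⟨by positivity, le_trans ?_ ht.2⟩
    calc (i : ℝ) * (t / N) ≤ N * (t / N) := by gcongr
      _ = t := by field_simp
  have claim : ∀ i : ℕ, i ≤ N → f ((i : ℝ) * (t / N)) - f 0 ≤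
      (∫ s in (0 : ℝ)..(i : ℝ) * (t / N), inner ℝ (b s) (u s)) +
        ε * ∫ s in (0 : ℝ)..(i : ℝ) * (t / N), ‖u s‖ := by
    intro i
    induction i with
    | zero => intro _; simp
    | succ i ih =>
      intro hi
      have hi' : i ≤ N := by omega
      have m1 := hmem i hi'
      have m2 := hmem (i + 1) hi
      set p : ℝ := (i : ℝ) * (t / N)
      set p' : ℝ := ((i + 1 : ℕ) : ℝ) * (t / N) with hp'
      have hpp : p' - p = t / N := by simp only [p, hp']; push_cast; ring
      have hle : p ≤ p' := by
        have : 0 ≤ t / N := div_nonneg ht.1 hN0.le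
        linarith
      have hlt : p' - p < δ := by
        rw [hpp, div_lt_iff₀ hN0]; rwa [div_lt_iff₀ hδ, mul_comm] at hN
      have iu := intervalIntegrable_Lp_time u m1 m2
      have step : f p' - f p ≤ (∫ s in p..p', inner ℝ (b s) (u s)) + ε * ∫ s in p..p', ‖u s‖ := by
        refine (hf p m1 p' m2 hle).trans ?_
        rw [primitive_sub_eq_integral u m1 m2, ← intervalIntegral.integral_const_mul,
          ← intervalIntegral.integral_add (hint _ m1 _ m2) (iu.norm.const_mul ε)]
        have e : inner ℝ (b p') (∫ s in p..p', u s) = ∫ s in p..p', inner ℝ (b p') (u s) :=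
          ((innerSL ℝ (b p')).intervalIntegral_comp_comm iu).symm
        rw [e]
        refine intervalIntegral.integral_mono_on hle ?_
          ((hint _ m1 _ m2).add (iu.norm.const_mul ε)) fun s hs => ?_
        · exact ⟨iu.1.const_inner _, iu.2.const_inner _⟩
        · have hs' : s ∈ Icc 0 T := ⟨m1.1.trans hs.1, hs.2.trans m2.2⟩
          have hd : ‖b p' - b s‖ ≤ ε := by
            rw [← dist_eq_norm]
            refine (hδ' _ m2 _ hs' ?_).le
            rw [Real.dist_eq, abs_of_nonneg (by linarith [hs.2])]
            linarith [hs.1]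
          have h1 : inner ℝ (b p' - b s) (u s) ≤ ε * ‖u s‖ :=
            (real_inner_le_norm _ _).trans (by gcongr)
          rw [inner_sub_left] at h1
          linarith
      rw [← intervalIntegral.integral_add_adjacent_intervals (hint _ h0 _ m1) (hint _ m1 _ m2),
        ← intervalIntegral.integral_add_adjacent_intervals
          (intervalIntegrable_Lp_time u h0 m1).norm iu.norm]
      have := ih hi'
      linarith
  have := claim N le_rfl
  rwa [show (N : ℝ) * (t / N) = t by field_simp] at this

theorem half_norm_primitive_sq_le_integral (u : Lp X 2 (timeMeasure T)) {t : ℝ}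
    (ht : t ∈ Icc 0 T) :
    2⁻¹ * ‖primitive u t‖ ^ 2 ≤ ∫ s in (0 : ℝ)..t, inner ℝ (primitive u s) (u s) := by
  have h := sub_le_integral_inner (f := fun t => 2⁻¹ * ‖primitive u t‖ ^ 2)
    (continuousOn_primitive u) u (fun s _ t _ _ => by
      rw [inner_sub_right, real_inner_self_eq_norm_sq]
      have := real_inner_le_norm (primitive u t) (primitive u s)
      nlinarith [sq_nonneg (‖primitive u t‖ - ‖primitive u s‖)]) ht
  simpa using h

/-- If `⟪w, w'⟫ ≤ c` almost everywhere and `w(0) = 0`, then `‖w‖² ≤ 2 ∫ c`. -/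
theorem norm_primitive_sq_le {u : Lp X 2 (timeMeasure T)} {c : ℝ → ℝ}
    (hc : Integrable c (timeMeasure T)) (hc0 : 0 ≤ᵐ[timeMeasure T] c)
    (h : ∀ᵐ t ∂timeMeasure T, inner ℝ (primitive u t) (u t) ≤ c t) {t : ℝ} (ht : t ∈ Icc 0 T) :
    ‖primitive u t‖ ^ 2 ≤ 2 * ∫ s in Ioo 0 T, c s := by
  have h1 := half_norm_primitive_sq_le_integral u ht
  have h2 : ∫ s in (0 : ℝ)..t, inner ℝ (primitive u s) (u s) ≤ ∫ s in Ioo 0 T, c s := by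
    rw [intervalIntegral.integral_of_le ht.1, integral_Ioc_eq_integral_Ioo]
    have hsub : Ioo 0 t ⊆ Ioo 0 T := Ioo_subset_Ioo_right ht.2
    refine (setIntegral_mono_ae_restrict ?_ (IntegrableOn.mono_set hc hsub)
      (ae_restrict_of_ae_restrict_of_subset hsub h)).trans
      (setIntegral_mono_set hc hc0 hsub.eventuallyLE)
    exact IntegrableOn.mono_set (integrable_real_inner_of_memLp (memLp_of_continuousOn
      (continuousOn_primitive u)) (Lp.memLp u)) hsub
  linarith

end Chain

/-! ### Regularized rate-independent evolutions in a Hilbert space -/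

section Evolution
variable {V : Type*} [NormedAddCommGroup V] [InnerProductSpace ℝ V] {T : ℝ}

/-- `E` is a smoothing of size `ρ` of the potential `D`, with gradient `Φ`: it lies between `D` and
`D + ρ m`, and its gradient is Lipschitz and takes values in the set of `ξ` with `⟪ξ, ·⟫ ≤ D`. -/
structure IsSmoothing (D : V → ℝ) (m ρ : ℝ) (E : V → ℝ) (Φ : V → V) : Prop where
  le : ∀ v, D v ≤ E v
  le_add : ∀ v, E v ≤ D v + ρ * m
  grad : ∀ v w, E v + inner ℝ (Φ v) (w - v) ≤ E w
  inner_le : ∀ v w, inner ℝ (Φ v) w ≤ D w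
  lipschitz : ∃ K, LipschitzWith K Φ
  map_zero : Φ 0 = 0

/-- `u` is the velocity of an inexact solution of the inclusion `ℓ ∈ ∂D(ż) + ρ ż + z`, `z(0) = 0`,
the subgradient inequality holding up to the error `ρ m`. For `ρ = 0` the solution is exact. -/
def IsApproxSolution (D : V → ℝ) (m ρ : ℝ) (ℓ u : Lp V 2 (timeMeasure T)) : Prop :=
  ∀ᵐ t ∂timeMeasure T, ∀ y,
    inner ℝ (ℓ t - primitive u t - ρ • u t) (y - u t) ≤ D y - D (u t) + ρ * m

variable {D : V → ℝ} {m ρ : ℝ} {E : V → ℝ} {Φ : V → V}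

theorem IsSmoothing.monotone (h : IsSmoothing D m ρ E Φ) (v w : V) :
    0 ≤ inner ℝ (Φ v - Φ w) (v - w) := by
  have h1 := h.grad v w
  have h2 := h.grad w v
  rw [← neg_sub v w, inner_neg_right] at h1
  rw [inner_sub_left]
  linarith

theorem IsSmoothing.strongMonotone (h : IsSmoothing D m ρ E Φ) (v w : V) :
    ρ * ‖v - w‖ ^ 2 ≤ inner ℝ ((Φ v + ρ • v) - (Φ w + ρ • w)) (v - w) := by
  have e : (Φ v + ρ • v) - (Φ w + ρ • w) = (Φ v - Φ w) + ρ • (v - w) := by module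
  rw [e, inner_add_left, real_inner_smul_left, real_inner_self_eq_norm_sq]
  linarith [h.monotone v w]

theorem IsSmoothing.isApproxSolution (h : IsSmoothing D m ρ E Φ) {ℓ u : Lp V 2 (timeMeasure T)}
    (hu : ∀ᵐ t ∂timeMeasure T, Φ (u t) + ρ • u t + primitive u t = ℓ t) :
    IsApproxSolution D m ρ ℓ u := by
  filter_upwards [hu] with t ht y
  have e : ℓ t - primitive u t - ρ • u t = Φ (u t) := by rw [← ht]; abel
  rw [e]
  linarith [h.grad (u t) y, h.le (u t), h.le_add y]

variable [CompleteSpace V]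

theorem inner_primitiveL2_nonneg (hT : 0 < T) (u : Lp V 2 (timeMeasure T)) :
    0 ≤ inner ℝ (primitiveL2 V T u) u := by
  have h1 := half_norm_primitive_sq_le_integral u ⟨hT.le, le_rfl⟩
  rw [L2.inner_def]
  have e : ∫ t, inner ℝ (primitiveL2 V T u t) (u t) ∂timeMeasure T =
      ∫ s in (0 : ℝ)..T, inner ℝ (primitive u s) (u s) := by
    rw [intervalIntegral.integral_of_le hT.le, integral_Ioc_eq_integral_Ioo]
    refine integral_congr_ae ?_
    filter_upwards [coeFn_primitiveL2 u] with t ht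
    rw [ht]
  rw [e]
  exact le_trans (by positivity) h1

/-- The regularized evolution `Φ(ż) + ρ ż + z = ℓ`, `z(0) = 0`, has a unique solution: as an
equation for `ż ∈ L²(I; V)` its operator is Lipschitz and strongly monotone. -/
theorem IsSmoothing.existsUnique (hT : 0 < T) (hρ : 0 < ρ) (h : IsSmoothing D m ρ E Φ)
    (ℓ : Lp V 2 (timeMeasure T)) :
    ∃! u : Lp V 2 (timeMeasure T),
      ∀ᵐ t ∂timeMeasure T, Φ (u t) + ρ • u t + primitive u t = ℓ t := by
  obtain ⟨K, hK⟩ := h.lipschitz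
  let A : Lp V 2 (timeMeasure T) → Lp V 2 (timeMeasure T) := fun u =>
    hK.compLp h.map_zero u + (ρ • u + primitiveL2 V T u)
  have hA : ∀ u, A u =ᵐ[timeMeasure T] fun t => Φ (u t) + ρ • u t + primitive u t := by
    intro u
    filter_upwards [Lp.coeFn_add (hK.compLp h.map_zero u) (ρ • u + primitiveL2 V T u),
      Lp.coeFn_add (ρ • u) (primitiveL2 V T u), Lp.coeFn_smul ρ u, coeFn_primitiveL2 u,
      hK.coeFn_compLp h.map_zero u] with t h1 h2 h3 h4 h5
    rw [h1, Pi.add_apply, h2, Pi.add_apply, h3, h4, h5, Pi.smul_apply, Function.comp_apply,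
      add_assoc]
  have hLip : LipschitzWith (K + ‖(ρ • ContinuousLinearMap.id ℝ (Lp V 2 (timeMeasure T)) +
      primitiveL2 V T)‖₊) A :=
    (hK.lipschitzWith_compLp h.map_zero).add (ContinuousLinearMap.lipschitz _)
  have hmon : ∀ u v, ρ * ‖u - v‖ ^ 2 ≤ inner ℝ (A u - A v) (u - v) := by
    intro u v
    have e : A u - A v = (hK.compLp h.map_zero u - hK.compLp h.map_zero v) +
        (ρ • (u - v) + primitiveL2 V T (u - v)) := by
      simp only [A, map_sub, smul_sub]; abel
    have h1 : 0 ≤ inner ℝ (hK.compLp h.map_zero u - hK.compLp h.map_zero v) (u - v) := by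
      rw [L2.inner_def]
      refine integral_nonneg_of_ae ?_
      filter_upwards [Lp.coeFn_sub (hK.compLp h.map_zero u) (hK.compLp h.map_zero v),
        Lp.coeFn_sub u v, hK.coeFn_compLp h.map_zero u, hK.coeFn_compLp h.map_zero v]
        with t h1 h2 h3 h4
      rw [h1, h2, Pi.sub_apply, Pi.sub_apply, h3, h4]
      exact h.monotone _ _
    rw [e, inner_add_left, inner_add_left, real_inner_smul_left, real_inner_self_eq_norm_sq]
    linarith [inner_primitiveL2_nonneg hT (u - v)]
  obtain ⟨u, hu⟩ := exists_eq_of_strongMonotone hLip hρ hmon ℓ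
  refine ⟨u, ?_, fun v hv => ?_⟩
  · filter_upwards [hA u] with t ht
    rw [← ht, hu]
  · have hv' : A v = ℓ := Lp.ext ((hA v).trans hv)
    have h1 := hmon v u
    rw [hv', hu, sub_self, inner_zero_left] at h1
    have h2 : ‖v - u‖ ^ 2 = 0 := le_antisymm (by nlinarith) (sq_nonneg _)
    exact sub_eq_zero.1 (norm_eq_zero.1 (pow_eq_zero_iff two_ne_zero |>.1 h2))

/-- The energy estimate for the regularized evolution. With `q = ℓ - z`, `b = ż` and
`Ψ = E + ρ/2 ‖·‖²` one has `q = ∇Ψ(b)`, so that `⟪q, b⟫ - Ψ(b)`, the conjugate of `Ψ` at `q`, has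
the derivative `⟪b, q'⟫ = ⟪ż, ℓ'⟫ - ‖ż‖²`. Compatibility of `ℓ(0)` makes its initial value
nonpositive. -/
theorem IsSmoothing.norm_sq_le (hT : 0 < T) (hρ : 0 < ρ) (h : IsSmoothing D m ρ E Φ)
    (hD0 : D 0 = 0) (ℓ : H1 V T) (hℓ : ∀ w, inner ℝ (H1.rep ℓ 0) w ≤ D w)
    {u : Lp V 2 (timeMeasure T)}
    (hu : ∀ᵐ t ∂timeMeasure T, Φ (u t) + ρ • u t + primitive u t = H1.val ℓ t) :
    ‖u‖ ^ 2 ≤ ‖H1.der ℓ‖ ^ 2 + 2 * (ρ * m) := by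
  obtain ⟨K, hK⟩ := h.lipschitz
  have hLip : LipschitzWith (K + ‖ρ • ContinuousLinearMap.id ℝ V‖₊) (fun v => Φ v + ρ • v) :=
    hK.add (ρ • ContinuousLinearMap.id ℝ V).lipschitz
  choose B hB using exists_eq_of_strongMonotone hLip hρ h.strongMonotone
  have hBlip : ∀ q q', ρ * ‖B q - B q'‖ ≤ ‖q - q'‖ := by
    intro q q'
    have h1 := h.strongMonotone (B q) (B q')
    rw [hB, hB] at h1
    have h2 := h1.trans (real_inner_le_norm _ _)
    rcases (norm_nonneg (B q - B q')).eq_or_lt with h3 | h3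
    · rw [← h3, mul_zero]; exact norm_nonneg _
    · refine le_of_mul_le_mul_right ?_ h3
      linarith [pow_two ‖B q - B q'‖]
  have hBc : Continuous B := by
    refine (LipschitzWith.of_dist_le_mul (K := ρ⁻¹.toNNReal) fun q q' => ?_).continuous
    rw [dist_eq_norm, dist_eq_norm, Real.coe_toNNReal _ (inv_pos.2 hρ).le, inv_mul_eq_div,
      le_div_iff₀ hρ, mul_comm]
    exact hBlip q q'
  -- The velocity has the continuous representative `b = B(q)`, `B` the inverse of `Φ + ρ`.
  set q : ℝ → V := fun t => H1.rep ℓ t - primitive u t with hq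
  have hqc : ContinuousOn q (Icc 0 T) :=
    (H1.isContRep_rep ℓ).1.sub (continuousOn_primitive u)
  set b : ℝ → V := fun t => B (q t) with hb
  have hbc : ContinuousOn b (Icc 0 T) := hBc.comp_continuousOn hqc
  have hΦb : ∀ t, Φ (b t) = q t - ρ • b t := fun t => eq_sub_of_add_eq (hB (q t))
  have hub : u =ᵐ[timeMeasure T] b := by
    filter_upwards [hu, (H1.isContRep_rep ℓ).2] with t h1 h2
    have h3 := h.strongMonotone (u t) (b t)
    rw [hΦb, sub_add_cancel, eq_sub_of_add_eq h1, h2] at h3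
    simp only [hq, sub_self, inner_zero_left] at h3
    have h4 : ‖u t - b t‖ ^ 2 = 0 := le_antisymm (by nlinarith) (sq_nonneg _)
    exact sub_eq_zero.1 (norm_eq_zero.1 (pow_eq_zero_iff two_ne_zero |>.1 h4))
  have hprim : ∀ s ∈ Icc 0 T, ∀ t ∈ Icc 0 T,
      primitive (H1.der ℓ - u) t - primitive (H1.der ℓ - u) s = q t - q s := by
    intro s hs t ht
    simp only [hq]
    rw [primitive_sub ht, primitive_sub hs, H1.rep_eq_add_primitive hT ℓ ht,
      H1.rep_eq_add_primitive hT ℓ hs]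
    abel
  have hTm : T ∈ Icc 0 T := ⟨hT.le, le_rfl⟩
  have chain := sub_le_integral_inner
    (f := fun t => inner ℝ (q t) (b t) - E (b t) - ρ / 2 * ‖b t‖ ^ 2) hbc (H1.der ℓ - u)
    (fun s hs t ht _ => by
      rw [hprim s hs t ht]
      have h1 := h.grad (b s) (b t)
      rw [hΦb, inner_sub_left, inner_sub_right, inner_sub_right, real_inner_smul_left,
        real_inner_smul_left, real_inner_self_eq_norm_sq] at h1
      rw [inner_sub_right, real_inner_comm (q t) (b t), real_inner_comm (q s) (b t)]
      have h2 : inner ℝ (b s) (b t) ≤ 2⁻¹ * (‖b s‖ ^ 2 + ‖b t‖ ^ 2) := by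
        nlinarith [real_inner_le_norm (b s) (b t), sq_nonneg (‖b s‖ - ‖b t‖)]
      have h3 := mul_le_mul_of_nonneg_left h2 hρ.le
      linarith) hTm
  have hend : -(ρ * m) ≤ inner ℝ (q T) (b T) - E (b T) - ρ / 2 * ‖b T‖ ^ 2 := by
    have h1 := h.grad (b T) 0
    rw [hΦb, zero_sub, inner_neg_right, inner_sub_left, real_inner_smul_left,
      real_inner_self_eq_norm_sq] at h1
    have h2 := h.le_add 0
    rw [hD0] at h2
    nlinarith [sq_nonneg ‖b T‖]
  have hstart : inner ℝ (q 0) (b 0) - E (b 0) - ρ / 2 * ‖b 0‖ ^ 2 ≤ 0 := by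
    have h1 := hℓ (b 0)
    have h2 := h.le (b 0)
    have h3 : q 0 = H1.rep ℓ 0 := by simp [hq]
    rw [h3]
    nlinarith [sq_nonneg ‖b 0‖]
  have e : ∫ s in (0 : ℝ)..T, inner ℝ (b s) ((H1.der ℓ - u) s) = inner ℝ u (H1.der ℓ - u) := by
    rw [intervalIntegral.integral_of_le hT.le, integral_Ioc_eq_integral_Ioo, L2.inner_def]
    refine integral_congr_ae ?_
    filter_upwards [hub] with t ht
    rw [ht]
  rw [e, inner_sub_right, real_inner_self_eq_norm_sq] at chain
  nlinarith [real_inner_le_norm u (H1.der ℓ), sq_nonneg (‖u‖ - ‖H1.der ℓ‖)]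

/-- Comparison of two inexact solutions: test each inequality with the velocity of the other. -/
theorem IsApproxSolution.norm_sub_sq_le (hT : 0 < T) (hm : 0 ≤ m) {ρ₁ ρ₂ : ℝ}
    (hρ₁ : 0 ≤ ρ₁) (hρ₂ : 0 ≤ ρ₂) {ℓ₁ ℓ₂ u₁ u₂ : Lp V 2 (timeMeasure T)}
    (h₁ : IsApproxSolution D m ρ₁ ℓ₁ u₁) (h₂ : IsApproxSolution D m ρ₂ ℓ₂ u₂) {t : ℝ}
    (ht : t ∈ Icc 0 T) :
    ‖primitive u₁ t - primitive u₂ t‖ ^ 2 ≤ 2 * (‖ℓ₁ - ℓ₂‖ * ‖u₁ - u₂‖ + ρ₁ / 4 * ‖u₂‖ ^ 2 +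
      ρ₂ / 4 * ‖u₁‖ ^ 2 + (ρ₁ + ρ₂) * m * T) := by
  let c : ℝ → ℝ := fun t => ‖(ℓ₁ - ℓ₂) t‖ * ‖(u₁ - u₂) t‖ + ρ₁ / 4 * ‖u₂ t‖ ^ 2 +
    ρ₂ / 4 * ‖u₁ t‖ ^ 2 + (ρ₁ + ρ₂) * m
  have i1 : Integrable (fun t => ‖(ℓ₁ - ℓ₂) t‖ * ‖(u₁ - u₂) t‖) (timeMeasure T) :=
    (Lp.memLp _).norm.integrable_mul (Lp.memLp _).norm
  have i2 : Integrable (fun t => ρ₁ / 4 * ‖u₂ t‖ ^ 2) (timeMeasure T) :=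
    (Lp.integrable_norm_sq u₂).const_mul _
  have i3 : Integrable (fun t => ρ₂ / 4 * ‖u₁ t‖ ^ 2) (timeMeasure T) :=
    (Lp.integrable_norm_sq u₁).const_mul _
  have i4 : Integrable (fun _ => (ρ₁ + ρ₂) * m) (timeMeasure T) := integrable_const _
  have hc : Integrable c (timeMeasure T) := ((i1.add i2).add i3).add i4
  have hc0 : 0 ≤ᵐ[timeMeasure T] c := Eventually.of_forall fun t => by
    simp only [Pi.zero_apply, c]; positivity
  have hle : ∀ᵐ t ∂timeMeasure T,
      inner ℝ (primitive (u₁ - u₂) t) ((u₁ - u₂) t) ≤ c t := by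
    filter_upwards [h₁, h₂, Lp.coeFn_sub u₁ u₂, Lp.coeFn_sub ℓ₁ ℓ₂,
      ae_restrict_mem measurableSet_Ioo] with t a1 a2 a3 a4 a5
    have b1 := a1 (u₂ t)
    have b2 := a2 (u₁ t)
    simp only [c]
    rw [primitive_sub (Ioo_subset_Icc_self a5), a3, a4, Pi.sub_apply, Pi.sub_apply]
    have b3 := real_inner_le_norm (ℓ₁ t - ℓ₂ t) (u₁ t - u₂ t)
    have b4 : inner ℝ (u₁ t) (u₂ t) ≤ ‖u₁ t‖ ^ 2 + ‖u₂ t‖ ^ 2 / 4 := by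
      nlinarith [real_inner_le_norm (u₁ t) (u₂ t), sq_nonneg (‖u₁ t‖ - ‖u₂ t‖ / 2)]
    have b5 : inner ℝ (u₁ t) (u₂ t) ≤ ‖u₁ t‖ ^ 2 / 4 + ‖u₂ t‖ ^ 2 := by
      nlinarith [real_inner_le_norm (u₁ t) (u₂ t), sq_nonneg (‖u₁ t‖ / 2 - ‖u₂ t‖)]
    have b6 := mul_le_mul_of_nonneg_left b4 hρ₁
    have b7 := mul_le_mul_of_nonneg_left b5 hρ₂
    simp only [inner_sub_left, inner_sub_right, real_inner_smul_left,
      real_inner_self_eq_norm_sq] at b1 b2 b3 ⊢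
    rw [real_inner_comm (u₁ t) (u₂ t)] at b2
    linarith
  have h := norm_primitive_sq_le hc hc0 hle ht
  rw [primitive_sub ht] at h
  refine h.trans ?_
  have e : ∫ s in Ioo 0 T, c s = (∫ t in Ioo 0 T, ‖(ℓ₁ - ℓ₂) t‖ * ‖(u₁ - u₂) t‖) +
      ρ₁ / 4 * ‖u₂‖ ^ 2 + ρ₂ / 4 * ‖u₁‖ ^ 2 + (ρ₁ + ρ₂) * m * T := by
    have s1 := integral_add ((i1.add i2).add i3) i4
    have s2 := integral_add (i1.add i2) i3
    have s3 := integral_add i1 i2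
    have s4 : ∫ t, ρ₁ / 4 * ‖u₂ t‖ ^ 2 ∂timeMeasure T = ρ₁ / 4 * ‖u₂‖ ^ 2 := by
      rw [integral_const_mul, Lp.norm_sq_eq_integral_norm_sq]
    have s5 : ∫ t, ρ₂ / 4 * ‖u₁ t‖ ^ 2 ∂timeMeasure T = ρ₂ / 4 * ‖u₁‖ ^ 2 := by
      rw [integral_const_mul, Lp.norm_sq_eq_integral_norm_sq]
    have s6 : ∫ _, (ρ₁ + ρ₂) * m ∂timeMeasure T = (ρ₁ + ρ₂) * m * T := by
      rw [integral_const, measureReal_restrict_apply_univ, Real.volume_real_Ioo_of_le hT.le]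
      simp [mul_comm]
    rw [s4] at s3
    rw [s5] at s2
    rw [s6] at s1
    exact s1.trans (congrArg (· + _) (s2.trans (congrArg (· + _) s3)))
  rw [e]
  gcongr
  exact integral_norm_mul_norm_le _ _

end Evolution

/-! ### The limit of vanishing regularization -/

section Limit
variable {V : Type*} [NormedAddCommGroup V] [InnerProductSpace ℝ V] {T : ℝ}

theorem tendsto_primitiveL2_of_tendsto_primitiveC {u : ℕ → Lp V 2 (timeMeasure T)}
    {u₀ : Lp V 2 (timeMeasure T)}
    (hC : Tendsto (fun n => primitiveC V T (u n)) atTop (𝓝 (primitiveC V T u₀))) :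
    Tendsto (fun n => primitiveL2 V T (u n)) atTop (𝓝 (primitiveL2 V T u₀)) := by
  rw [tendsto_iff_norm_sub_tendsto_zero] at hC ⊢
  refine squeeze_zero (fun _ => norm_nonneg _) (fun n => ?_)
    (by simpa using
      hC.const_mul ((measureUnivNNReal (timeMeasure T) : ℝ) ^ (2 : ENNReal).toReal⁻¹))
  rw [← map_sub, ← map_sub]
  refine Lp.norm_le_of_ae_bound (norm_nonneg _) ?_
  filter_upwards [coeFn_primitiveL2 (u n - u₀), ae_restrict_mem measurableSet_Ioo] with t h1 h2
  rw [h1]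
  exact (primitiveC V T (u n - u₀)).norm_coe_le_norm ⟨t, Ioo_subset_Icc_self h2⟩

variable {D : V → ℝ} {m : ℝ}

theorem tendsto_inner_of_tendsto_weakly {E : Type*} [NormedAddCommGroup E] [InnerProductSpace ℝ E]
    {x y : ℕ → E} {x₀ y₀ : E} {M : ℝ} (hM : ∀ n, ‖y n‖ ≤ M) (hx : Tendsto x atTop (𝓝 x₀))
    (hy : ∀ e, Tendsto (fun n => inner ℝ e (y n)) atTop (𝓝 (inner ℝ e y₀))) :
    Tendsto (fun n => (inner ℝ (x n) (y n) : ℝ)) atTop (𝓝 (inner ℝ x₀ y₀)) := by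
  have h1 : Tendsto (fun n => (inner ℝ (x n - x₀) (y n) : ℝ)) atTop (𝓝 0) := by
    rw [tendsto_iff_norm_sub_tendsto_zero] at hx
    refine squeeze_zero_norm (fun n => ?_) (by simpa using hx.mul_const M)
    exact (norm_inner_le_norm _ _).trans (by gcongr; exact hM n)
  have h2 := h1.add (hy x₀)
  rw [zero_add] at h2
  refine h2.congr fun n => ?_
  rw [← inner_add_left, sub_add_cancel]

variable {E : ℝ → V → ℝ} {Φ : ℝ → V → V} {ρ : ℕ → ℝ}

/-- A limit of solutions of the regularized evolutions satisfies the stability condition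
`ℓ - z ∈ ∂D(0)`. -/
theorem ae_inner_le_of_tendsto (h : ∀ ρ > 0, IsSmoothing D m ρ (E ρ) (Φ ρ))
    (hρ : ∀ n, 0 < ρ n) (hρ0 : Tendsto ρ atTop (𝓝 0)) {ℓ u₀ : Lp V 2 (timeMeasure T)}
    {u : ℕ → Lp V 2 (timeMeasure T)} {M : ℝ} (hM : ∀ n, ‖u n‖ ≤ M)
    (hu : ∀ n, ∀ᵐ t ∂timeMeasure T, Φ (ρ n) (u n t) + ρ n • u n t + primitive (u n) t = ℓ t)
    (hC : Tendsto (fun n => primitiveC V T (u n)) atTop (𝓝 (primitiveC V T u₀))) :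
    ∀ᵐ t ∂timeMeasure T, ∀ w, inner ℝ (ℓ t - primitive u₀ t) w ≤ D w := by
  have h1 : Tendsto (fun n => ρ n • u n) atTop (𝓝 0) := by
    refine squeeze_zero_norm (fun n => ?_) (by simpa using hρ0.mul_const M)
    rw [norm_smul, Real.norm_of_nonneg (hρ n).le]
    exact mul_le_mul_of_nonneg_left (hM n) (hρ n).le
  obtain ⟨ns, hns, h2⟩ := (tendstoInMeasure_of_tendsto_Lp h1).exists_seq_tendsto_ae
  have h3 : ∀ᵐ t ∂timeMeasure T, ∀ n, (ρ n • u n) t = ρ n • u n t :=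
    ae_all_iff.2 fun n => Lp.coeFn_smul _ _
  filter_upwards [h2, h3, ae_all_iff.2 hu, Lp.coeFn_zero V 2 (timeMeasure T),
    ae_restrict_mem measurableSet_Ioo] with t a1 a2 a3 a4 a5 w
  have b1 : Tendsto (fun n => primitive (u n) t) atTop (𝓝 (primitive u₀ t)) :=
    (ContinuousMap.tendsto_iff_tendstoUniformly.1 hC).tendsto_at
      (⟨t, Ioo_subset_Icc_self a5⟩ : Icc (0 : ℝ) T)
  rw [a4] at a1
  have b2 := ((tendsto_const_nhds (x := ℓ t)).sub (b1.comp hns.tendsto_atTop)).sub a1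
  rw [Pi.zero_apply, sub_zero] at b2
  refine le_of_tendsto (b2.inner tendsto_const_nhds) (Eventually.of_forall fun k => ?_)
  rw [Function.comp_apply, a2, ← a3 (ns k)]
  refine le_of_eq_of_le ?_ ((h _ (hρ (ns k))).inner_le (u (ns k) t) w)
  congr 1
  abel

/-- A weak limit of velocities of inexact solutions satisfies the energy inequality
`D(ż) ≤ ⟪ℓ - z, ż⟫` in integrated form. The dissipation is weakly lower semicontinuous because of
the subgradient inequality for its smoothings at the limit. -/
theorem integral_le_inner_of_tendsto (hT : 0 < T) (hm : 0 ≤ m)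
    (h : ∀ ρ > 0, IsSmoothing D m ρ (E ρ) (Φ ρ))
    (hD0 : D 0 = 0)
    (hDi : ∀ u : Lp V 2 (timeMeasure T), Integrable (fun t => D (u t)) (timeMeasure T))
    (hρ : ∀ n, 0 < ρ n) (hρ0 : Tendsto ρ atTop (𝓝 0)) {ℓ u₀ : Lp V 2 (timeMeasure T)}
    {u : ℕ → Lp V 2 (timeMeasure T)} {M : ℝ} (hM : ∀ n, ‖u n‖ ≤ M)
    (hu : ∀ n, IsApproxSolution D m (ρ n) ℓ (u n))
    (hC : Tendsto (fun n => primitiveC V T (u n)) atTop (𝓝 (primitiveC V T u₀)))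
    (hw : ∀ e, Tendsto (fun n => inner ℝ e (u n)) atTop (𝓝 (inner ℝ e u₀))) :
    ∫ t in Ioo 0 T, D (u₀ t) ≤ inner ℝ (ℓ - primitiveL2 V T u₀) u₀ := by
  suffices H : ∀ σ > 0, ∫ t in Ioo 0 T, D (u₀ t) ≤
      inner ℝ (ℓ - primitiveL2 V T u₀) u₀ + σ * (m * T) by
    refine le_of_forall_pos_le_add fun ε hε => (H (ε / (m * T + 1)) (by positivity)).trans ?_
    gcongr
    rw [div_mul_eq_mul_div, div_le_iff₀ (by positivity)]
    nlinarith
  intro σ hσ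
  -- `ξ` is the gradient at `u₀` of the smoothing of size `σ`.
  obtain ⟨K, hK⟩ := (h σ hσ).lipschitz
  set ξ : Lp V 2 (timeMeasure T) := hK.compLp (h σ hσ).map_zero u₀ with hξ
  have hn : ∀ n, ∫ t in Ioo 0 T, D (u₀ t) ≤ inner ℝ (ℓ - primitiveL2 V T (u n)) (u n) -
      inner ℝ ξ (u n - u₀) + (ρ n + σ) * (m * T) := by
    intro n
    have i1 := L2.integrable_inner (𝕜 := ℝ) (ℓ - primitiveL2 V T (u n)) (u n)
    have i2 := L2.integrable_inner (𝕜 := ℝ) ξ (u n - u₀)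
    have i3 : Integrable (fun _ => (ρ n + σ) * m) (timeMeasure T) := integrable_const _
    have e3 : ∫ _, (ρ n + σ) * m ∂timeMeasure T = (ρ n + σ) * (m * T) := by
      rw [integral_const, measureReal_restrict_apply_univ, Real.volume_real_Ioo_of_le hT.le,
        sub_zero, smul_eq_mul]
      ring
    have e4 := integral_add (i1.sub i2) i3
    rw [integral_sub' i1 i2, e3] at e4
    rw [L2.inner_def, L2.inner_def, ← e4]
    refine integral_mono_ae (hDi u₀) ((i1.sub i2).add i3) ?_
    filter_upwards [hu n, Lp.coeFn_sub ℓ (primitiveL2 V T (u n)), coeFn_primitiveL2 (u n),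
      Lp.coeFn_sub (u n) u₀, hK.coeFn_compLp (h σ hσ).map_zero u₀] with t a1 a2 a3 a4 a5
    have b1 := a1 0
    have b2 := (h σ hσ).grad (u₀ t) (u n t)
    have b3 := (h σ hσ).le_add (u n t)
    have b4 := (h σ hσ).le (u₀ t)
    simp only [Pi.sub_apply, a2, a3, a4]
    rw [hξ, a5, Function.comp_apply]
    rw [hD0, zero_sub, inner_neg_right, inner_sub_left _ (ρ n • _), real_inner_smul_left,
      real_inner_self_eq_norm_sq] at b1
    have b5 : 0 ≤ ρ n * ‖u n t‖ ^ 2 := mul_nonneg (hρ n).le (sq_nonneg _)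
    linarith
  have l1 := tendsto_inner_of_tendsto_weakly hM
    ((tendsto_const_nhds (x := ℓ)).sub (tendsto_primitiveL2_of_tendsto_primitiveC hC)) hw
  have l2 : Tendsto (fun n => (inner ℝ ξ (u n - u₀) : ℝ)) atTop (𝓝 0) := by
    have := (hw ξ).sub_const (inner ℝ ξ u₀)
    rw [sub_self] at this
    exact this.congr fun n => (inner_sub_right _ _ _).symm
  have l3 := ((l1.sub l2).add ((hρ0.add_const σ).mul_const (m * T)))
  rw [sub_zero, zero_add] at l3
  exact ge_of_tendsto' l3 hn

variable [CompleteSpace V]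

theorem IsApproxSolution.norm_primitiveC_sub_le (hT : 0 < T) (hm : 0 ≤ m) {ρ₁ ρ₂ : ℝ}
    (hρ₁ : 0 ≤ ρ₁) (hρ₂ : 0 ≤ ρ₂) {ℓ₁ ℓ₂ u₁ u₂ : Lp V 2 (timeMeasure T)}
    (h₁ : IsApproxSolution D m ρ₁ ℓ₁ u₁) (h₂ : IsApproxSolution D m ρ₂ ℓ₂ u₂) :
    ‖primitiveC V T u₁ - primitiveC V T u₂‖ ≤ Real.sqrt (2 * (‖ℓ₁ - ℓ₂‖ * ‖u₁ - u₂‖ +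
      ρ₁ / 4 * ‖u₂‖ ^ 2 + ρ₂ / 4 * ‖u₁‖ ^ 2 + (ρ₁ + ρ₂) * m * T)) := by
  rw [ContinuousMap.norm_le _ (Real.sqrt_nonneg _)]
  exact fun t => Real.le_sqrt_of_sq_le (h₁.norm_sub_sq_le hT hm hρ₁ hρ₂ h₂ t.2)

theorem IsApproxSolution.unique (hT : 0 < T) (hm : 0 ≤ m) {ℓ u v : Lp V 2 (timeMeasure T)}
    (hu : IsApproxSolution D m 0 ℓ u) (hv : IsApproxSolution D m 0 ℓ v) : u = v := by
  have h := hu.norm_primitiveC_sub_le hT hm le_rfl le_rfl hv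
  simp only [sub_self, norm_zero, zero_mul, zero_div, add_zero, mul_zero, Real.sqrt_zero] at h
  exact primitiveC_injective (sub_eq_zero.1 (norm_le_zero_iff.1 h))

/-- The rate-independent evolution `ℓ ∈ ∂D(ż) + z`, `z(0) = 0`, has a solution for compatible data:
the solutions of the regularized evolutions are a Cauchy sequence in `C([0, T]; V)` with
bounded velocities. -/
theorem exists_isApproxSolution_zero (hT : 0 < T) (hm : 0 ≤ m)
    (h : ∀ ρ > 0, IsSmoothing D m ρ (E ρ) (Φ ρ)) (hD0 : D 0 = 0)
    (hDi : ∀ u : Lp V 2 (timeMeasure T), Integrable (fun t => D (u t)) (timeMeasure T))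
    (ℓ : H1 V T) (hℓ : ∀ w, inner ℝ (H1.rep ℓ 0) w ≤ D w) :
    ∃ u, IsApproxSolution D m 0 (H1.val ℓ) u := by
  let ρ : ℕ → ℝ := fun n => 1 / ((n : ℝ) + 1)
  have hρ : ∀ n, 0 < ρ n := fun n => Nat.one_div_pos_of_nat
  have hρ1 : ∀ n, ρ n ≤ 1 := fun n => by
    simp only [ρ]
    rw [div_le_one (by positivity)]
    have : (0 : ℝ) ≤ n := n.cast_nonneg
    linarith
  have hρ0 : Tendsto ρ atTop (𝓝 0) := tendsto_one_div_add_atTop_nhds_zero_nat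
  choose u hu using fun n => ((h _ (hρ n)).existsUnique hT (hρ n) (H1.val ℓ)).exists
  have hA := fun n => (h _ (hρ n)).isApproxSolution (hu n)
  set S : ℝ := ‖H1.der ℓ‖ ^ 2 + 2 * m with hS
  have hS0 : 0 ≤ S := by positivity
  have hsq : ∀ n, ‖u n‖ ^ 2 ≤ S := fun n => by
    have := (h _ (hρ n)).norm_sq_le hT (hρ n) hD0 ℓ hℓ (hu n)
    have := mul_le_mul_of_nonneg_right (hρ1 n) hm
    linarith
  have hM : ∀ n, ‖u n‖ ≤ Real.sqrt S := fun n => Real.le_sqrt_of_sq_le (hsq n)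
  have hcau : CauchySeq fun n => primitiveC V T (u n) := by
    refine cauchySeq_of_le_tendsto_0 (fun N => Real.sqrt (2 * (ρ N / 4 * S + ρ N / 4 * S +
      (ρ N + ρ N) * m * T))) (fun n k N hn hk => ?_) ?_
    · rw [dist_eq_norm]
      refine ((hA n).norm_primitiveC_sub_le hT hm (hρ n).le (hρ k).le (hA k)).trans
        (Real.sqrt_le_sqrt ?_)
      rw [sub_self, norm_zero, zero_mul, zero_add]
      have a1 : ρ n ≤ ρ N := Nat.one_div_le_one_div hn
      have a2 : ρ k ≤ ρ N := Nat.one_div_le_one_div hk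
      have a3 := hsq n
      have a4 := hsq k
      have a5 := (hρ N).le
      gcongr
    · have h1 : Tendsto (fun N => 2 * (ρ N / 4 * S + ρ N / 4 * S + (ρ N + ρ N) * m * T)) atTop
          (𝓝 (2 * (0 / 4 * S + 0 / 4 * S + (0 + 0) * m * T))) :=
        ((((hρ0.div_const 4).mul_const S).add ((hρ0.div_const 4).mul_const S)).add
          (((hρ0.add hρ0).mul_const m).mul_const T)).const_mul 2
      have h2 := h1.sqrt
      simpa using h2
  obtain ⟨y, hy⟩ := cauchySeq_tendsto_of_complete hcau
  obtain ⟨u₀, hu₀, hw⟩ := exists_tendsto_inner_of_bounded (primitiveC V T) primitiveC_injective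
    hM hy
  rw [← hu₀] at hy
  refine ⟨u₀, ?_⟩
  have s1 := ae_inner_le_of_tendsto h hρ hρ0 hM hu hy
  have s2 := integral_le_inner_of_tendsto hT hm h hD0 hDi hρ hρ0 hM hA hy hw
  -- The energy inequality holds pointwise, as stability gives the opposite inequality.
  have i1 := L2.integrable_inner (𝕜 := ℝ) (H1.val ℓ - primitiveL2 V T u₀) u₀
  have s3 : 0 ≤ᵐ[timeMeasure T]
      fun t => D (u₀ t) - inner ℝ ((H1.val ℓ - primitiveL2 V T u₀) t) (u₀ t) := by
    filter_upwards [s1, Lp.coeFn_sub (H1.val ℓ) (primitiveL2 V T u₀), coeFn_primitiveL2 u₀]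
      with t a1 a2 a3
    rw [a2, Pi.sub_apply, a3]
    exact sub_nonneg.2 (a1 _)
  have s4 := (integral_eq_zero_iff_of_nonneg_ae s3 ((hDi u₀).sub i1)).1 (by
    refine le_antisymm ?_ (integral_nonneg_of_ae s3)
    rw [integral_sub (hDi u₀) i1, ← L2.inner_def]
    exact sub_nonpos.2 s2)
  filter_upwards [s1, s4, Lp.coeFn_sub (H1.val ℓ) (primitiveL2 V T u₀), coeFn_primitiveL2 u₀]
    with t a1 a2 a3 a4 y
  rw [a3, Pi.sub_apply, a4, Pi.zero_apply] at a2
  rw [zero_smul, sub_zero, inner_sub_right, zero_mul]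
  linarith [a1 y]

/-- Stability of the solutions of the regularized evolutions as `ρ → 0` under strong convergence of
the data in `L²(I; V)`. -/
theorem IsApproxSolution.tendsto (hT : 0 < T) (hm : 0 ≤ m)
    (hρ : ∀ n, 0 < ρ n) (hρ0 : Tendsto ρ atTop (𝓝 0)) {ℓ u : ℕ → Lp V 2 (timeMeasure T)}
    {ℓ₀ u₀ : Lp V 2 (timeMeasure T)} {M : ℝ} (hM : ∀ n, ‖u n‖ ≤ M)
    (hu : ∀ n, IsApproxSolution D m (ρ n) (ℓ n) (u n)) (hu₀ : IsApproxSolution D m 0 ℓ₀ u₀)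
    (hℓ : Tendsto ℓ atTop (𝓝 ℓ₀)) :
    Tendsto (fun n => primitiveC V T (u n)) atTop (𝓝 (primitiveC V T u₀)) ∧
      TendstoWeakly u u₀ := by
  have hM0 : 0 ≤ M := (norm_nonneg _).trans (hM 0)
  have hC : Tendsto (fun n => primitiveC V T (u n)) atTop (𝓝 (primitiveC V T u₀)) := by
    rw [tendsto_iff_norm_sub_tendsto_zero] at hℓ ⊢
    have h1 : Tendsto (fun n => Real.sqrt (2 * (‖ℓ n - ℓ₀‖ * (M + ‖u₀‖) + ρ n / 4 * ‖u₀‖ ^ 2 +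
        ρ n * m * T))) atTop
        (𝓝 (Real.sqrt (2 * (0 * (M + ‖u₀‖) + 0 / 4 * ‖u₀‖ ^ 2 + 0 * m * T)))) :=
      ((((hℓ.mul_const _).add ((hρ0.div_const 4).mul_const _)).add
        ((hρ0.mul_const m).mul_const T)).const_mul 2).sqrt
    refine squeeze_zero (fun _ => norm_nonneg _) (fun n => ?_)
      (by simpa only [zero_mul, zero_div, add_zero, mul_zero, Real.sqrt_zero] using h1)
    refine ((hu n).norm_primitiveC_sub_le hT hm (hρ n).le le_rfl hu₀).trans (Real.sqrt_le_sqrt ?_)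
    rw [zero_div, zero_mul, add_zero, add_zero]
    gcongr
    exact (norm_sub_le _ _).trans (add_le_add_left (hM n) _)
  refine ⟨hC, fun f => ?_⟩
  obtain ⟨a, ha, hw⟩ := exists_tendsto_inner_of_bounded (primitiveC V T) primitiveC_injective hM hC
  rw [primitiveC_injective ha] at hw
  have := hw ((InnerProductSpace.toDual ℝ _).symm f)
  simpa only [InnerProductSpace.toDual_symm_apply] using this

end Limit

/-! ### The regularized modulus and the smoothed dissipation -/

section Modulus
variable {r : ℝ → ℝ → ℝ} {ρ : ℝ}

namespace IsRegularizedAbs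

theorem differentiable (hr : IsRegularizedAbs r) (hρ : 0 < ρ) : Differentiable ℝ (r ρ) :=
  (hr.contDiff ρ hρ).differentiable (by norm_num)

theorem monotone_deriv (hr : IsRegularizedAbs r) (hρ : 0 < ρ) : Monotone (deriv (r ρ)) := by
  have := (hr.convex ρ hρ).monotoneOn_deriv fun x _ => hr.differentiable hρ x
  rwa [monotoneOn_univ] at this

/-- The tangent inequality for the convex function `|·|_ρ`. -/
theorem add_deriv_mul_le (hr : IsRegularizedAbs r) (hρ : 0 < ρ) (v w : ℝ) :
    r ρ v + deriv (r ρ) v * (w - v) ≤ r ρ w := by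
  rcases lt_trichotomy v w with h | rfl | h
  · have h1 := (hr.convex ρ hρ).le_slope_of_hasDerivAt (mem_univ v) (mem_univ w) h
      (hr.differentiable hρ v).hasDerivAt
    rw [slope_def_field, le_div_iff₀ (by linarith)] at h1
    linarith
  · simp
  · have h1 := (hr.convex ρ hρ).slope_le_of_hasDerivAt (mem_univ w) (mem_univ v) h
      (hr.differentiable hρ v).hasDerivAt
    rw [slope_def_field, div_le_iff₀ (by linarith)] at h1
    linarith

theorem deriv_neg (hr : IsRegularizedAbs r) (hρ : 0 < ρ) (v : ℝ) :
    deriv (r ρ) (-v) = -deriv (r ρ) v := by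
  have h1 : (fun x => r ρ (-x)) = r ρ := funext (hr.even ρ hρ)
  have h2 := deriv_comp_neg (r ρ) v
  rw [h1] at h2
  linarith

theorem deriv_zero (hr : IsRegularizedAbs r) (hρ : 0 < ρ) : deriv (r ρ) 0 = 0 := by
  have := hr.deriv_neg hρ 0
  rw [neg_zero] at this
  linarith

theorem deriv_le_one (hr : IsRegularizedAbs r) (hρ : 0 < ρ) (v : ℝ) : deriv (r ρ) v ≤ 1 := by
  refine (hr.monotone_deriv hρ (le_max_left v (ρ + 1))).trans ?_
  have hw : ρ < max v (ρ + 1) := lt_of_lt_of_le (by linarith) (le_max_right _ _)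
  have h1 : r ρ =ᶠ[𝓝 (max v (ρ + 1))] id := by
    filter_upwards [Ioi_mem_nhds hw] with x hx
    have hx' : ρ < x := hx
    rw [hr.eq_abs ρ hρ x (hx'.le.trans (le_abs_self x)), abs_of_pos (hρ.trans hx')]
    rfl
  rw [h1.deriv_eq]
  simp

theorem abs_deriv_le_one (hr : IsRegularizedAbs r) (hρ : 0 < ρ) (v : ℝ) :
    |deriv (r ρ) v| ≤ 1 := by
  refine abs_le.2 ⟨?_, hr.deriv_le_one hρ v⟩
  have := hr.deriv_le_one hρ (-v)
  rw [hr.deriv_neg hρ] at this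
  linarith

theorem lipschitzWith_deriv (hr : IsRegularizedAbs r) (hρ : 0 < ρ) :
    LipschitzWith (2 / ρ).toNNReal (deriv (r ρ)) := by
  have h2 : ContDiff ℝ 1 (deriv (r ρ)) := by
    have h := hr.contDiff ρ hρ
    rw [show (2 : WithTop ℕ∞) = 1 + 1 by norm_num, contDiff_succ_iff_deriv] at h
    exact h.2.2
  refine lipschitzWith_of_nnnorm_deriv_le (h2.differentiable (by norm_num)) fun v => ?_
  rw [← NNReal.coe_le_coe, coe_nnnorm, Real.coe_toNNReal _ (by positivity), Real.norm_eq_abs,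
    abs_of_nonneg (hr.monotone_deriv hρ).deriv_nonneg]
  exact hr.deriv2_le ρ hρ v

theorem abs_eq (hr : IsRegularizedAbs r) (hρ : 0 < ρ) (v : ℝ) : r ρ |v| = r ρ v := by
  rcases abs_choice v with h | h <;> rw [h]
  exact hr.even ρ hρ v

theorem abs_le (hr : IsRegularizedAbs r) (hρ : 0 < ρ) (v : ℝ) : |v| ≤ r ρ v := by
  rcases le_or_gt ρ |v| with h | h
  · exact (hr.eq_abs ρ hρ v h).ge
  · have h1 := hr.add_deriv_mul_le hρ ρ |v|
    rw [hr.abs_eq hρ, hr.eq_abs ρ hρ ρ (le_abs_self ρ), abs_of_pos hρ] at h1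
    nlinarith [hr.deriv_le_one hρ ρ]

theorem le_abs_add (hr : IsRegularizedAbs r) (hρ : 0 < ρ) (v : ℝ) : r ρ v ≤ |v| + ρ := by
  rcases le_or_gt ρ |v| with h | h
  · rw [hr.eq_abs ρ hρ v h]; linarith
  · have h1 := hr.add_deriv_mul_le hρ |v| ρ
    rw [hr.abs_eq hρ, hr.eq_abs ρ hρ ρ (le_abs_self ρ), abs_of_pos hρ] at h1
    have h2 := hr.monotone_deriv hρ (abs_nonneg v)
    rw [hr.deriv_zero hρ] at h2
    nlinarith [abs_nonneg v]

end IsRegularizedAbs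
end Modulus

section Dissipation
variable {d : ℕ} {Ω : BoundedOpen d} {r : ℝ → ℝ → ℝ} {ρ : ℝ}

theorem integrable_L2 (f : L2 Ω) : Integrable f Ω.measure := (Lp.memLp f).integrable (by norm_num)

theorem IsRegularizedAbs.integrable_comp (hr : IsRegularizedAbs r) (hρ : 0 < ρ) (f : L2 Ω) :
    Integrable (fun x => r ρ (f x)) Ω.measure := by
  refine Integrable.mono' ((integrable_L2 f).abs.add (integrable_const ρ)) ?_ ?_
  · exact (hr.differentiable hρ).continuous.comp_aestronglyMeasurable (Lp.aestronglyMeasurable f)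
  · refine Eventually.of_forall fun x => ?_
    rw [Real.norm_of_nonneg ((abs_nonneg _).trans (hr.abs_le hρ _))]
    exact hr.le_abs_add hρ _

/-- The Nemytskii operator of `|·|_ρ'` on `L²(Ω)`. -/
def modulusDeriv (hr : IsRegularizedAbs r) (hρ : 0 < ρ) (f : L2 Ω) : L2 Ω :=
  (hr.lipschitzWith_deriv hρ).compLp (hr.deriv_zero hρ) f

theorem coeFn_modulusDeriv (hr : IsRegularizedAbs r) (hρ : 0 < ρ) (f : L2 Ω) :
    modulusDeriv hr hρ f =ᵐ[Ω.measure] fun x => deriv (r ρ) (f x) :=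
  (hr.lipschitzWith_deriv hρ).coeFn_compLp (hr.deriv_zero hρ) f

theorem integrable_modulusDeriv_mul (hr : IsRegularizedAbs r) (hρ : 0 < ρ) (f g : L2 Ω) :
    Integrable (fun x => deriv (r ρ) (f x) * g x) Ω.measure := by
  refine (L2.integrable_inner (𝕜 := ℝ) g (modulusDeriv hr hρ f)).congr ?_
  filter_upwards [coeFn_modulusDeriv hr hρ f] with x hx
  rw [hx]
  rfl

variable [NeZero d]

/-- The smoothed dissipation `∫ |v|_ρ`. -/
def smoothDissipation (r : ℝ → ℝ → ℝ) (ρ : ℝ) (v : H01 Ω) : ℝ :=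
  ∫ x in Ω.carrier, r ρ (H01.toL2 v x)

open Classical in
/-- The gradient in `H₀¹(Ω)` of the smoothed dissipation, a function of all `ρ` which is `0` where
`|·|_ρ` has no meaning. -/
def smoothGrad (r : ℝ → ℝ → ℝ) (ρ : ℝ) (v : H01 Ω) : H01 Ω :=
  if h : IsRegularizedAbs r ∧ 0 < ρ then
    ContinuousLinearMap.adjoint H01.toL2 (modulusDeriv h.1 h.2 (H01.toL2 v)) else 0

theorem smoothGrad_eq (hr : IsRegularizedAbs r) (hρ : 0 < ρ) (v : H01 Ω) :
    smoothGrad r ρ v = ContinuousLinearMap.adjoint H01.toL2 (modulusDeriv hr hρ (H01.toL2 v)) :=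
  dif_pos ⟨hr, hρ⟩

theorem inner_smoothGrad (hr : IsRegularizedAbs r) (hρ : 0 < ρ) (v w : H01 Ω) :
    inner ℝ (smoothGrad r ρ v) w =
      ∫ x in Ω.carrier, deriv (r ρ) (H01.toL2 v x) * H01.toL2 w x := by
  rw [smoothGrad_eq hr hρ, ContinuousLinearMap.adjoint_inner_left, L2.inner_def]
  refine integral_congr_ae ?_
  filter_upwards [coeFn_modulusDeriv hr hρ (H01.toL2 v)] with x hx
  rw [hx, real_inner_comm]
  rfl

theorem isSmoothing_smoothDissipation (hr : IsRegularizedAbs r) (hρ : 0 < ρ) :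
    IsSmoothing (dissipation (Ω := Ω)) (Ω.measure.real univ) ρ (smoothDissipation r ρ)
      (smoothGrad r ρ) where
  le v := integral_mono (integrable_L2 _).abs (hr.integrable_comp hρ _) fun x => hr.abs_le hρ _
  le_add v := by
    have h := integral_add (integrable_L2 (H01.toL2 v)).abs
      (integrable_const (μ := Ω.measure) ρ)
    rw [integral_const, smul_eq_mul, mul_comm] at h
    rw [dissipation, ← h]
    exact integral_mono (hr.integrable_comp hρ _)
      ((integrable_L2 (H01.toL2 v)).abs.add (integrable_const ρ)) fun x => hr.le_abs_add hρ _
  grad v w := by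
    rw [inner_smoothGrad hr hρ, smoothDissipation, smoothDissipation,
      ← integral_add (hr.integrable_comp hρ _) (integrable_modulusDeriv_mul hr hρ _ _)]
    refine integral_mono_ae ((hr.integrable_comp hρ _).add (integrable_modulusDeriv_mul hr hρ _ _))
      (hr.integrable_comp hρ _) ?_
    rw [map_sub]
    filter_upwards [Lp.coeFn_sub (H01.toL2 w) (H01.toL2 v)] with x hx
    rw [hx]
    exact hr.add_deriv_mul_le hρ _ _
  inner_le v w := by
    rw [inner_smoothGrad hr hρ]
    refine integral_mono (integrable_modulusDeriv_mul hr hρ _ _) (integrable_L2 _).abs fun x => ?_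
    refine (le_abs_self _).trans ?_
    rw [abs_mul]
    exact mul_le_of_le_one_left (abs_nonneg _) (hr.abs_deriv_le_one hρ _)
  lipschitz := by
    have h := (ContinuousLinearMap.adjoint (H01.toL2 (Ω := Ω))).lipschitz.comp
      (((hr.lipschitzWith_deriv hρ).lipschitzWith_compLp (p := 2) (μ := Ω.measure)
        (hr.deriv_zero hρ)).comp (H01.toL2 (Ω := Ω)).lipschitz)
    exact ⟨_, fun v w => by rw [smoothGrad_eq hr hρ, smoothGrad_eq hr hρ]; exact h v w⟩
  map_zero := by
    rw [smoothGrad_eq hr hρ, map_zero, modulusDeriv, LipschitzWith.compLp_zero, map_zero]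

theorem dissipation_zero : dissipation (0 : H01 Ω) = 0 := by
  rw [dissipation, map_zero]
  refine integral_eq_zero_of_ae ?_
  filter_upwards [Lp.coeFn_zero ℝ 2 Ω.measure] with x hx
  show |(0 : L2 Ω) x| = 0
  rw [hx]
  simp

theorem continuous_dissipation : Continuous (dissipation (Ω := Ω)) := by
  have h : Continuous fun f : L2 Ω => ∫ x in Ω.carrier, |f x| := by
    refine (LipschitzWith.of_dist_le_mul (K := (Real.sqrt (Ω.measure.real univ)).toNNReal)
      fun f g => ?_).continuous
    rw [Real.coe_toNNReal _ (Real.sqrt_nonneg _), dist_eq_norm f g, Real.dist_eq,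
      ← integral_sub (integrable_L2 f).abs (integrable_L2 g).abs]
    refine le_trans ?_ (integral_norm_le_sqrt_mul_norm (f - g))
    refine abs_integral_le_integral_abs.trans (integral_mono_ae
      ((integrable_L2 f).abs.sub (integrable_L2 g).abs).abs (integrable_L2 (f - g)).norm ?_)
    filter_upwards [Lp.coeFn_sub f g] with x hx
    rw [hx]
    exact abs_abs_sub_abs_le _ _
  exact h.comp H01.toL2.continuous

theorem integrable_dissipation {T : ℝ} (u : Lp (H01 Ω) 2 (timeMeasure T)) :
    Integrable (fun t => dissipation (u t)) (timeMeasure T) := by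
  refine Integrable.mono' (g := fun t => Real.sqrt (Ω.measure.real univ) *
    (‖H01.toL2 (Ω := Ω)‖ * ‖u t‖)) (((integrable_Lp_time u).norm.const_mul _).const_mul _)
    (continuous_dissipation.comp_aestronglyMeasurable (Lp.aestronglyMeasurable u))
    (Eventually.of_forall fun t => ?_)
  rw [dissipation, Real.norm_of_nonneg (integral_nonneg fun x => abs_nonneg _)]
  refine (integral_norm_le_sqrt_mul_norm (H01.toL2 (u t))).trans ?_
  gcongr
  exact ContinuousLinearMap.le_opNorm _ _

end Dissipation

/-! ### Images of Bochner-Sobolev functions under bounded operators -/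

section Map
variable {X Y : Type*} [NormedAddCommGroup X] [InnerProductSpace ℝ X] [CompleteSpace X]
  [NormedAddCommGroup Y] [InnerProductSpace ℝ Y] [CompleteSpace Y] {T : ℝ}

theorem IsWeakDeriv.clm_comp (A : X →L[ℝ] Y) {u v : ℝ → X} (hu : Integrable u (timeMeasure T))
    (hv : Integrable v (timeMeasure T)) (h : IsWeakDeriv T u v) :
    IsWeakDeriv T (fun t => A (u t)) (fun t => A (v t)) := by
  intro φ h1 h2 h3
  have e := congrArg A (h φ h1 h2 h3)
  rw [map_neg, ← A.integral_comp_comm (integrable_smul_test (h1.continuous_deriv (by simp)) hu),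
    ← A.integral_comp_comm (integrable_smul_test h1.continuous hv)] at e
  simpa only [map_smul] using e

/-- The image `A ∘ u` of `u ∈ H¹(I; X)` under a bounded operator `A`. -/
def H1.map (A : X →L[ℝ] Y) (u : H1 X T) : H1 Y T :=
  ⟨WithLp.toLp 2 (A.compLp (H1.val u), A.compLp (H1.der u)), by
    have h := IsWeakDeriv.clm_comp A (integrable_Lp_time (H1.val u)) (integrable_Lp_time (H1.der u))
      u.2
    refine (h.congr_left (A.coeFn_compLp' _)).congr_right ?_
    exact A.coeFn_compLp' _⟩

theorem H1.val_map (A : X →L[ℝ] Y) (u : H1 X T) : H1.val (H1.map A u) = A.compLp (H1.val u) := rfl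

theorem H1.rep_map (hT : 0 < T) (A : X →L[ℝ] Y) (u : H1 X T) {t : ℝ} (ht : t ∈ Icc 0 T) :
    H1.rep (H1.map A u) t = A (H1.rep u t) := by
  refine (H1.isContRep_rep _).eqOn hT (f' := fun t => A (H1.rep u t))
    ⟨A.continuous.comp_continuousOn (H1.isContRep_rep u).1, ?_⟩ ht
  filter_upwards [A.coeFn_compLp' (H1.val u), (H1.isContRep_rep u).2] with t h1 h2
  rw [H1.val_map, h1, h2]

end Map

/-! ### Compactness of the embedding of `H₀¹(Ω)` into `L²(Ω)` -/

section CauchySchwarz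

theorem sq_integral_le_mul_integral_sq {α : Type*} [MeasurableSpace α] {μ : Measure α}
    [IsFiniteMeasure μ] {g : α → ℝ} (hg : MemLp g 2 μ) :
    (∫ x, g x ∂μ) ^ 2 ≤ μ.real univ * ∫ x, g x ^ 2 ∂μ := by
  have h1 := integral_norm_le_sqrt_mul_norm (hg.toLp g)
  have e1 : ∫ x, ‖hg.toLp g x‖ ∂μ = ∫ x, ‖g x‖ ∂μ := by
    refine integral_congr_ae ?_
    filter_upwards [hg.coeFn_toLp] with x hx
    rw [hx]
  have e2 : ‖hg.toLp g‖ ^ 2 = ∫ x, g x ^ 2 ∂μ := by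
    rw [Lp.norm_sq_eq_integral_norm_sq]
    refine integral_congr_ae ?_
    filter_upwards [hg.coeFn_toLp] with x hx
    rw [hx, Real.norm_eq_abs, sq_abs]
  rw [e1] at h1
  have h2 := (norm_integral_le_integral_norm g).trans h1
  rw [Real.norm_eq_abs] at h2
  rw [← sq_abs, ← e2, ← Real.sq_sqrt (measureReal_nonneg (μ := μ) (s := univ)), ← mul_pow]
  gcongr

end CauchySchwarz

section Rellich
variable {d : ℕ}

/-- Translations of a test function in `L²`. -/
theorem lintegral_sub_translate_sq_le {φ : EuclideanSpace ℝ (Fin d) → ℝ} (h1 : ContDiff ℝ ∞ φ)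
    (h : EuclideanSpace ℝ (Fin d)) :
    ∫⁻ x, ENNReal.ofReal ((φ x - φ (x - h)) ^ 2) ≤
      ENNReal.ofReal (‖h‖ ^ 2) * ∫⁻ x, ENNReal.ofReal (‖gradient φ x‖ ^ 2) := by
  have hd : Differentiable ℝ φ := h1.differentiable (by simp)
  have hfc : Continuous (fderiv ℝ φ) := h1.continuous_fderiv (by simp)
  have hgc : Continuous (gradient φ) :=
    (InnerProductSpace.toDual ℝ (EuclideanSpace ℝ (Fin d))).symm.continuous.comp hfc
  have hnorm : ∀ x, ‖gradient φ x‖ = ‖fderiv ℝ φ x‖ := fun x => by simp [gradient]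
  let μ : Measure ℝ := volume.restrict (Ioc 0 1)
  have hμ : IsFiniteMeasure μ := ⟨by simp [μ]⟩
  have hμ1 : μ.real univ = 1 := by simp [μ]
  have hint : ∀ {f : ℝ → ℝ}, Continuous f → Integrable f μ := fun hf =>
    (hf.integrableOn_Icc (a := 0) (b := 1)).mono_set Ioc_subset_Icc_self
  -- The fundamental theorem of calculus along the segment, and the Cauchy-Schwarz inequality.
  have pt : ∀ x, (φ x - φ (x - h)) ^ 2 ≤ ‖h‖ ^ 2 * ∫ s, ‖gradient φ (x - s • h)‖ ^ 2 ∂μ := by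
    intro x
    have hc : Continuous fun s : ℝ => fderiv ℝ φ (x - s • h) (-h) :=
      (hfc.comp (by fun_prop)).clm_apply continuous_const
    have ftc : ∫ s, fderiv ℝ φ (x - s • h) (-h) ∂μ = φ (x - h) - φ x := by
      have hder : ∀ s ∈ uIcc (0 : ℝ) 1, HasDerivAt (fun s : ℝ => φ (x - s • h))
          (fderiv ℝ φ (x - s • h) (-h)) s := by
        intro s _
        have h2 : HasDerivAt (fun s : ℝ => x - s • h) (-h) s := by
          simpa using ((hasDerivAt_id s).smul_const h).const_sub x
        exact (hd _).hasFDerivAt.comp_hasDerivAt s h2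
      have := intervalIntegral.integral_eq_sub_of_hasDerivAt hder (hc.intervalIntegrable 0 1)
      rw [intervalIntegral.integral_of_le zero_le_one] at this
      simpa using this
    have hL : MemLp (fun s : ℝ => fderiv ℝ φ (x - s • h) (-h)) 2 μ := by
      rw [memLp_two_iff_integrable_sq hc.aestronglyMeasurable]
      exact hint (by fun_prop)
    have cs := sq_integral_le_mul_integral_sq hL
    rw [ftc, hμ1, one_mul] at cs
    rw [sub_sq_comm, ← integral_const_mul]
    refine cs.trans (integral_mono (hint (by fun_prop)) (hint ?_) fun s => ?_)
    · have : Continuous fun s : ℝ => gradient φ (x - s • h) := hgc.comp (by fun_prop)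
      fun_prop
    · show (fderiv ℝ φ (x - s • h) (-h)) ^ 2 ≤ ‖h‖ ^ 2 * ‖gradient φ (x - s • h)‖ ^ 2
      rw [← mul_pow, ← sq_abs]
      gcongr
      rw [hnorm, mul_comm]
      simpa using (fderiv ℝ φ (x - s • h)).le_opNorm (-h)
  have hjoint : Continuous fun p : EuclideanSpace ℝ (Fin d) × ℝ =>
      ENNReal.ofReal (‖gradient φ (p.1 - p.2 • h)‖ ^ 2) := by
    have : Continuous fun p : EuclideanSpace ℝ (Fin d) × ℝ => gradient φ (p.1 - p.2 • h) :=
      hgc.comp (by fun_prop)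
    exact ENNReal.continuous_ofReal.comp (by fun_prop)
  calc ∫⁻ x, ENNReal.ofReal ((φ x - φ (x - h)) ^ 2)
      ≤ ∫⁻ x, ENNReal.ofReal (‖h‖ ^ 2) *
          ∫⁻ s, ENNReal.ofReal (‖gradient φ (x - s • h)‖ ^ 2) ∂μ := by
        refine lintegral_mono fun x => ?_
        have hc : Continuous fun s : ℝ => gradient φ (x - s • h) := hgc.comp (by fun_prop)
        rw [← ofReal_integral_eq_lintegral_ofReal (hint (by fun_prop))
          (Eventually.of_forall fun _ => sq_nonneg _), ← ENNReal.ofReal_mul (sq_nonneg _)]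
        exact ENNReal.ofReal_le_ofReal (pt x)
    _ = ENNReal.ofReal (‖h‖ ^ 2) *
          ∫⁻ s, (∫⁻ x, ENNReal.ofReal (‖gradient φ (x - s • h)‖ ^ 2)) ∂μ := by
        rw [lintegral_const_mul' _ _ ENNReal.ofReal_ne_top,
          lintegral_lintegral_swap hjoint.aemeasurable]
    _ = ENNReal.ofReal (‖h‖ ^ 2) * ∫⁻ x, ENNReal.ofReal (‖gradient φ x‖ ^ 2) := by
        congr 1
        have : ∀ s : ℝ, ∫⁻ x, ENNReal.ofReal (‖gradient φ (x - s • h)‖ ^ 2) =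
            ∫⁻ x, ENNReal.ofReal (‖gradient φ x‖ ^ 2) := fun s =>
          lintegral_sub_right_eq_self (fun x => ENNReal.ofReal (‖gradient φ x‖ ^ 2)) (s • h)
        simp_rw [this]
        rw [lintegral_const]
        simp [μ]

/-- A test function is close in `L²` to its averages over balls of radius `ε`. Both sides carry the
factor `c`, the volume of the ball. -/
theorem lintegral_sub_ball_integral_sq_le {φ : EuclideanSpace ℝ (Fin d) → ℝ}
    (h1 : ContDiff ℝ ∞ φ) {ε c : ℝ}
    (hc : c = volume.real (Metric.closedBall (0 : EuclideanSpace ℝ (Fin d)) ε)) :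
    ∫⁻ x, ENNReal.ofReal ((c * φ x - ∫ h in Metric.closedBall 0 ε, φ (x - h)) ^ 2) ≤
      ENNReal.ofReal (c ^ 2 * ε ^ 2) * ∫⁻ x, ENNReal.ofReal (‖gradient φ x‖ ^ 2) := by
  have hφ : Continuous φ := h1.continuous
  let μ : Measure (EuclideanSpace ℝ (Fin d)) := volume.restrict (Metric.closedBall 0 ε)
  have hcomp : IsCompact (Metric.closedBall (0 : EuclideanSpace ℝ (Fin d)) ε) :=
    isCompact_closedBall _ _
  have hμ : IsFiniteMeasure μ := ⟨by simpa [μ] using hcomp.measure_lt_top⟩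
  have hμ1 : μ.real univ = c := by simp [μ, hc]
  have hc0 : 0 ≤ c := hc ▸ measureReal_nonneg
  have hint : ∀ {f : EuclideanSpace ℝ (Fin d) → ℝ}, Continuous f → Integrable f μ := fun hf =>
    hf.continuousOn.integrableOn_compact hcomp
  have pt : ∀ x, (c * φ x - ∫ h, φ (x - h) ∂μ) ^ 2 ≤ c * ∫ h, (φ x - φ (x - h)) ^ 2 ∂μ := by
    intro x
    have hL : MemLp (fun h => φ x - φ (x - h)) 2 μ := by
      rw [memLp_two_iff_integrable_sq (Continuous.aestronglyMeasurable (by fun_prop))]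
      exact hint (by fun_prop)
    have cs := sq_integral_le_mul_integral_sq hL
    rw [integral_sub (integrable_const _) (hint (by fun_prop)), integral_const, hμ1,
      smul_eq_mul] at cs
    exact cs
  have hjoint : Continuous fun p : EuclideanSpace ℝ (Fin d) × EuclideanSpace ℝ (Fin d) =>
      ENNReal.ofReal ((φ p.1 - φ (p.1 - p.2)) ^ 2) :=
    ENNReal.continuous_ofReal.comp (by fun_prop)
  calc ∫⁻ x, ENNReal.ofReal ((c * φ x - ∫ h, φ (x - h) ∂μ) ^ 2)
      ≤ ∫⁻ x, ENNReal.ofReal c * ∫⁻ h, ENNReal.ofReal ((φ x - φ (x - h)) ^ 2) ∂μ := by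
        refine lintegral_mono fun x => ?_
        rw [← ofReal_integral_eq_lintegral_ofReal (hint (by fun_prop))
          (Eventually.of_forall fun _ => sq_nonneg _), ← ENNReal.ofReal_mul hc0]
        exact ENNReal.ofReal_le_ofReal (pt x)
    _ = ENNReal.ofReal c * ∫⁻ h, (∫⁻ x, ENNReal.ofReal ((φ x - φ (x - h)) ^ 2)) ∂μ := by
        rw [lintegral_const_mul' _ _ ENNReal.ofReal_ne_top,
          lintegral_lintegral_swap hjoint.aemeasurable]
    _ ≤ ENNReal.ofReal c * ∫⁻ _, ENNReal.ofReal (ε ^ 2) *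
          (∫⁻ x, ENNReal.ofReal (‖gradient φ x‖ ^ 2)) ∂μ := by
        gcongr ENNReal.ofReal c * ?_
        refine lintegral_mono_ae ?_
        filter_upwards [ae_restrict_mem Metric.isClosed_closedBall.measurableSet] with h hh
        refine (lintegral_sub_translate_sq_le h1 h).trans ?_
        have : ‖h‖ ≤ ε := by simpa using hh
        gcongr
    _ = _ := by
        have hμ2 : μ univ = ENNReal.ofReal c := by
          rw [← hμ1, measureReal_def, ENNReal.ofReal_toReal (measure_ne_top _ _)]
        rw [lintegral_const, hμ2, ENNReal.ofReal_mul (by positivity), pow_two c,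
          ENNReal.ofReal_mul hc0]
        ring

variable {Ω : BoundedOpen d}

/-- The integral of `f ∈ L²(Ω)`, extended by zero, over the ball of radius `ε` around `x`. -/
def ballIntegral (ε : ℝ) (f : L2 Ω) (x : EuclideanSpace ℝ (Fin d)) : ℝ :=
  ∫ y, (Metric.closedBall x ε).indicator f y ∂Ω.measure

theorem stronglyMeasurable_ballIntegral (ε : ℝ) (f : L2 Ω) :
    StronglyMeasurable (ballIntegral ε f) := by
  have hs : MeasurableSet {p : EuclideanSpace ℝ (Fin d) × EuclideanSpace ℝ (Fin d) |
      dist p.2 p.1 ≤ ε} := (isClosed_le (by fun_prop) (by fun_prop)).measurableSet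
  exact ((Lp.stronglyMeasurable f).comp_measurable
    measurable_snd).indicator hs |>.integral_prod_right'

theorem ballIntegral_eq_inner (ε : ℝ) (f : L2 Ω) (x : EuclideanSpace ℝ (Fin d)) :
    ballIntegral ε f x = inner ℝ (indicatorConstLp 2
      (Metric.isClosed_closedBall.measurableSet : MeasurableSet (Metric.closedBall x ε))
      (measure_ne_top Ω.measure _) (1 : ℝ)) f := by
  rw [L2.inner_indicatorConstLp_one, ballIntegral,
    integral_indicator Metric.isClosed_closedBall.measurableSet]

theorem abs_ballIntegral_le (ε : ℝ) (f : L2 Ω) (x : EuclideanSpace ℝ (Fin d)) :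
    |ballIntegral ε f x| ≤ Real.sqrt (Ω.measure.real univ) * ‖f‖ := by
  refine le_trans ?_ (integral_norm_le_sqrt_mul_norm f)
  refine abs_integral_le_integral_abs.trans (integral_mono_of_nonneg
    (Eventually.of_forall fun _ => abs_nonneg _) (integrable_L2 f).norm
    (Eventually.of_forall fun y => ?_))
  exact norm_indicator_le_norm_self (f : EuclideanSpace ℝ (Fin d) → ℝ) y

theorem tendsto_integral_ballIntegral_sq (ε : ℝ) {f : ℕ → L2 Ω} {f₀ : L2 Ω} {M : ℝ}
    (hM : ∀ n, ‖f n‖ ≤ M)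
    (hf : ∀ e, Tendsto (fun n => inner ℝ e (f n)) atTop (𝓝 (inner ℝ e f₀))) :
    Tendsto (fun n => ∫ x in Ω.carrier, ballIntegral ε (f n) x ^ 2) atTop
      (𝓝 (∫ x in Ω.carrier, ballIntegral ε f₀ x ^ 2)) := by
  refine tendsto_integral_of_dominated_convergence
    (fun _ => (Real.sqrt (Ω.measure.real univ) * M) ^ 2) (fun n => ?_) (integrable_const _)
    (fun n => Eventually.of_forall fun x => ?_) (Eventually.of_forall fun x => ?_)
  · exact ((stronglyMeasurable_ballIntegral ε (f n)).pow 2).aestronglyMeasurable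
  · rw [Real.norm_of_nonneg (sq_nonneg _), ← sq_abs]
    gcongr
    exact (abs_ballIntegral_le ε (f n) x).trans (by gcongr; exact hM n)
  · simp only [ballIntegral_eq_inner]
    exact (hf _).pow 2

/-- An element of `testPairs` is controlled in `L²` by its gradient, with a small factor, and by its
integrals over balls. -/
theorem norm_sq_le_of_mem_testPairs {q : L2 Ω × L2Vec Ω} (hq : q ∈ testPairs Ω) {ε c : ℝ}
    (hc : c = volume.real (Metric.closedBall (0 : EuclideanSpace ℝ (Fin d)) ε)) :
    c ^ 2 * ‖q.1‖ ^ 2 ≤ 2 * (c ^ 2 * ε ^ 2 * ‖q.2‖ ^ 2) +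
      2 * ∫ x in Ω.carrier, ballIntegral ε q.1 x ^ 2 := by
  obtain ⟨φ, h1, h2, h3, h4, h5⟩ := hq
  have hφ : Continuous φ := h1.continuous
  have hfc : Continuous (fderiv ℝ φ) := h1.continuous_fderiv (by simp)
  have hgc : Continuous (gradient φ) :=
    (InnerProductSpace.toDual ℝ (EuclideanSpace ℝ (Fin d))).symm.continuous.comp hfc
  have hball : ∀ x, ballIntegral ε q.1 x = ∫ h in Metric.closedBall 0 ε, φ (x - h) := by
    intro x
    have e1 : ballIntegral ε q.1 x = ∫ y in Ω.carrier, (Metric.closedBall x ε).indicator φ y := by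
      refine integral_congr_ae ?_
      filter_upwards [h4] with y hy
      by_cases hy' : y ∈ Metric.closedBall x ε <;> simp [hy', hy]
    have e2 : ∫ y in Ω.carrier, (Metric.closedBall x ε).indicator φ y =
        ∫ y, (Metric.closedBall x ε).indicator φ y :=
      setIntegral_eq_integral_of_forall_compl_eq_zero fun y hy => by
        have : φ y = 0 := image_eq_zero_of_notMem_tsupport fun hh => hy (h3 hh)
        by_cases hy' : y ∈ Metric.closedBall x ε <;> simp [hy', this]
    rw [e1, e2, ← integral_sub_left_eq_self _ volume x,
      ← integral_indicator Metric.isClosed_closedBall.measurableSet]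
    congr 1
    ext h
    by_cases hh : ‖h‖ ≤ ε <;> simp [indicator, dist_eq_norm, hh]
  have n1 : ∀ᵐ x ∂Ω.measure, c ^ 2 * ‖q.1 x‖ ^ 2 ≤ 2 * (c * φ x - ballIntegral ε q.1 x) ^ 2 +
      2 * ballIntegral ε q.1 x ^ 2 := by
    filter_upwards [h4] with x hx
    rw [hx, Real.norm_eq_abs, sq_abs]
    nlinarith [sq_nonneg (c * φ x - 2 * ballIntegral ε q.1 x)]
  have n2 : ‖q.2‖ ^ 2 = ∫ x in Ω.carrier, ‖gradient φ x‖ ^ 2 := by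
    rw [Lp.norm_sq_eq_integral_norm_sq]
    refine integral_congr_ae ?_
    filter_upwards [h5] with x hx
    rw [hx]
  have i2 : Integrable (fun x => ballIntegral ε q.1 x ^ 2) Ω.measure := by
    refine Integrable.mono' (integrable_const ((Real.sqrt (Ω.measure.real univ) * ‖q.1‖) ^ 2))
      ((stronglyMeasurable_ballIntegral ε q.1).pow 2).aestronglyMeasurable
      (Eventually.of_forall fun x => ?_)
    rw [Real.norm_of_nonneg (sq_nonneg _), ← sq_abs]
    gcongr
    exact abs_ballIntegral_le ε q.1 x
  have hm : AEStronglyMeasurable (fun x => (c * φ x - ballIntegral ε q.1 x) ^ 2) Ω.measure :=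
    ((hφ.stronglyMeasurable.const_mul c).sub
      (stronglyMeasurable_ballIntegral ε q.1)).aestronglyMeasurable.pow 2
  have hgrad : ∫⁻ x, ENNReal.ofReal (‖gradient φ x‖ ^ 2) = ENNReal.ofReal (‖q.2‖ ^ 2) := by
    have hs : HasCompactSupport fun x => ‖gradient φ x‖ ^ 2 := by
      refine (h2.fderiv (𝕜 := ℝ)).mono fun x hx => ?_
      rw [Function.mem_support] at hx ⊢
      intro h; exact hx (by simp [gradient, h])
    rw [← ofReal_integral_eq_lintegral_ofReal
      ((by fun_prop : Continuous fun x => ‖gradient φ x‖ ^ 2).integrable_of_hasCompactSupport hs)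
      (Eventually.of_forall fun _ => sq_nonneg _), n2,
      setIntegral_eq_integral_of_forall_compl_eq_zero]
    intro x hx
    have : fderiv ℝ φ x = 0 := image_eq_zero_of_notMem_tsupport fun h =>
      hx (h3 (tsupport_fderiv_subset ℝ h))
    simp [gradient, this]
  have key : ∫⁻ x in Ω.carrier, ENNReal.ofReal ((c * φ x - ballIntegral ε q.1 x) ^ 2) ≤
      ENNReal.ofReal (c ^ 2 * ε ^ 2 * ‖q.2‖ ^ 2) := by
    refine (setLIntegral_le_lintegral _ _).trans ?_
    simp only [hball]
    refine (lintegral_sub_ball_integral_sq_le h1 hc).trans ?_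
    rw [hgrad, ← ENNReal.ofReal_mul (by positivity)]
  have i1 : Integrable (fun x => (c * φ x - ballIntegral ε q.1 x) ^ 2) Ω.measure := by
    refine ⟨hm, ?_⟩
    rw [hasFiniteIntegral_iff_ofReal (Eventually.of_forall fun _ => sq_nonneg _)]
    exact key.trans_lt ENNReal.ofReal_lt_top
  have n3 : ∫ x in Ω.carrier, (c * φ x - ballIntegral ε q.1 x) ^ 2 ≤ c ^ 2 * ε ^ 2 * ‖q.2‖ ^ 2 := by
    rw [integral_eq_lintegral_of_nonneg_ae (Eventually.of_forall fun _ => sq_nonneg _) hm]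
    exact ENNReal.toReal_le_of_le_ofReal (by positivity) key
  have n4 := integral_mono_ae ((Lp.integrable_norm_sq q.1).const_mul (c ^ 2))
    ((i1.const_mul 2).add (i2.const_mul 2)) n1
  rw [integral_const_mul, ← Lp.norm_sq_eq_integral_norm_sq] at n4
  have n5 := integral_add (i1.const_mul 2) (i2.const_mul 2)
  rw [integral_const_mul, integral_const_mul] at n5
  exact n4.trans (n5.trans_le (by linarith))

variable [NeZero d]

/-- The estimate of `norm_sq_le_of_mem_testPairs` extends to `H₀¹(Ω)` by density. -/
theorem norm_toL2_sq_le (v : H01 Ω) {ε c : ℝ}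
    (hc : c = volume.real (Metric.closedBall (0 : EuclideanSpace ℝ (Fin d)) ε)) :
    c ^ 2 * ‖H01.toL2 v‖ ^ 2 ≤ 2 * (c ^ 2 * ε ^ 2 * ‖v‖ ^ 2) +
      2 * ∫ x in Ω.carrier, ballIntegral ε (H01.toL2 v) x ^ 2 := by
  have hv : v.1 ∈ closure (testPairs Ω : Set (L2 Ω × L2Vec Ω)) := v.2
  obtain ⟨q, hq, hlim⟩ := mem_closure_iff_seq_limit.1 hv
  have l1 : Tendsto (fun n => (q n).1) atTop (𝓝 (H01.toL2 v)) :=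
    (continuous_fst.tendsto _).comp hlim
  have l2 : Tendsto (fun n => (q n).2) atTop (𝓝 (H01.grad v)) :=
    (continuous_snd.tendsto _).comp hlim
  obtain ⟨M, hM⟩ := l1.norm.bddAbove_range
  have l3 := tendsto_integral_ballIntegral_sq ε (fun n => hM ⟨n, rfl⟩)
    (fun e => tendsto_const_nhds.inner l1)
  rw [H01.norm_eq]
  exact le_of_tendsto_of_tendsto' ((l1.norm.pow 2).const_mul _)
    ((((l2.norm.pow 2).const_mul _).const_mul 2).add (l3.const_mul 2))
    fun n => norm_sq_le_of_mem_testPairs (hq n) hc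

/-- Rellich's theorem: a bounded sequence of `H₀¹(Ω)` which is weakly null in `L²(Ω)` converges
strongly in `L²(Ω)`. Its averages over balls of a fixed radius tend to zero by dominated
convergence. -/
theorem tendsto_toL2_of_tendsto_weakly {v : ℕ → H01 Ω} {M : ℝ} (hM : ∀ n, ‖v n‖ ≤ M)
    (hv : ∀ e, Tendsto (fun n => inner ℝ e (H01.toL2 (v n))) atTop (𝓝 0)) :
    Tendsto (fun n => H01.toL2 (v n)) atTop (𝓝 0) := by
  have hM0 : 0 ≤ M := (norm_nonneg _).trans (hM 0)
  rw [Metric.tendsto_atTop]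
  intro δ hδ
  -- The gradient term of `norm_toL2_sq_le` is at most `c² δ² / 2` for this radius.
  set ε : ℝ := δ / (2 * (M + 1)) with hε
  have hε0 : 0 < ε := by positivity
  set c : ℝ := volume.real (Metric.closedBall (0 : EuclideanSpace ℝ (Fin d)) ε) with hc
  have hc0 : 0 < c := ENNReal.toReal_pos (Metric.measure_closedBall_pos _ _ hε0).ne'
    measure_closedBall_lt_top.ne
  have l1 : Tendsto (fun n => ∫ x in Ω.carrier, ballIntegral ε (H01.toL2 (v n)) x ^ 2) atTop
      (𝓝 0) := by
    have := tendsto_integral_ballIntegral_sq (f₀ := 0) ε (f := fun n => H01.toL2 (v n))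
      (M := ‖H01.toL2 (Ω := Ω)‖ * M)
      (fun n => (ContinuousLinearMap.le_opNorm _ _).trans (by gcongr; exact hM n))
      (fun e => by rw [inner_zero_right]; exact hv e)
    simpa [ballIntegral_eq_inner] using this
  obtain ⟨N, hN⟩ := Metric.tendsto_atTop.1 l1 (c ^ 2 * δ ^ 2 / 8) (by positivity)
  refine ⟨N, fun n hn => ?_⟩
  have a1 := hN n hn
  rw [dist_zero_right] at a1 ⊢
  have a2 := (le_abs_self _).trans_lt a1
  have a3 := norm_toL2_sq_le (v n) hc
  have a4 : ε * ‖v n‖ ≤ δ / 2 := by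
    rw [hε, div_mul_eq_mul_div, div_le_div_iff₀ (by positivity) two_pos]
    nlinarith [hM n, norm_nonneg (v n)]
  have a5 : ε ^ 2 * ‖v n‖ ^ 2 ≤ δ ^ 2 / 4 := by
    rw [← mul_pow]
    calc (ε * ‖v n‖) ^ 2 ≤ (δ / 2) ^ 2 := by gcongr
      _ = _ := by ring
  have a6 : c ^ 2 * ‖H01.toL2 (v n)‖ ^ 2 < c ^ 2 * δ ^ 2 := by
    have := mul_le_mul_of_nonneg_left a5 (sq_nonneg c)
    nlinarith
  exact lt_of_pow_lt_pow_left₀ 2 hδ.le (lt_of_mul_lt_mul_left a6 (sq_nonneg c))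

/-- The embedding `L²(Ω) → H⁻¹(Ω) ≅ H₀¹(Ω)` maps weakly null sequences to null sequences. -/
theorem tendsto_adjoint_toL2_of_tendsto_weakly {f : ℕ → L2 Ω} {M : ℝ} (hM : ∀ n, ‖f n‖ ≤ M)
    (hf : ∀ e, Tendsto (fun n => inner ℝ e (f n)) atTop (𝓝 0)) :
    Tendsto (fun n => ContinuousLinearMap.adjoint H01.toL2 (f n)) atTop (𝓝 0) := by
  have hM0 : 0 ≤ M := (norm_nonneg _).trans (hM 0)
  set A : L2 Ω →L[ℝ] H01 Ω := ContinuousLinearMap.adjoint H01.toL2 with hA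
  have l1 : Tendsto (fun n => H01.toL2 (A (f n))) atTop (𝓝 0) := by
    refine tendsto_toL2_of_tendsto_weakly (M := ‖A‖ * M)
      (fun n => (A.le_opNorm _).trans (by gcongr; exact hM n)) fun e => ?_
    refine (hf (H01.toL2 (A e))).congr fun n => ?_
    rw [hA, ← ContinuousLinearMap.adjoint_inner_left, ContinuousLinearMap.adjoint_inner_right]
  have l2 : Tendsto (fun n => ‖A (f n)‖ ^ 2) atTop (𝓝 0) := by
    refine squeeze_zero (fun _ => sq_nonneg _) (fun n => ?_)
      (by simpa using l1.norm.mul_const M)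
    rw [← real_inner_self_eq_norm_sq, hA, ContinuousLinearMap.adjoint_inner_right]
    exact (real_inner_le_norm _ _).trans (by gcongr; exact hM n)
  rw [tendsto_zero_iff_norm_tendsto_zero]
  have := l2.sqrt
  simpa [Real.sqrt_sq] using this

end Rellich

/-! ### Weak convergence of the data -/

section WeakData
variable {X : Type*} [NormedAddCommGroup X] [InnerProductSpace ℝ X] [CompleteSpace X] {T : ℝ}

/-- The embedding `H¹(I; X) → C([0, T]; X)` is bounded: compare `u(t)` with `u(s)` and average over
`s`. -/
theorem H1.exists_norm_rep_le (hT : 0 < T) :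
    ∃ C, ∀ u : H1 X T, ∀ t ∈ Icc 0 T, ‖H1.rep u t‖ ≤ C * ‖u‖ := by
  set K := Real.sqrt ((timeMeasure T).real univ) with hK
  have hμ : (timeMeasure T).real univ = T := by
    rw [measureReal_restrict_apply_univ, Real.volume_real_Ioo_of_le hT.le, sub_zero]
  refine ⟨(K + T * (2 * K)) / T, fun u t ht => ?_⟩
  have h1 : ∀ᵐ s ∂timeMeasure T, ‖H1.rep u t‖ ≤ ‖H1.val u s‖ + 2 * K * ‖u‖ := by
    filter_upwards [(H1.isContRep_rep u).2, ae_restrict_mem measurableSet_Ioo] with s hs hs'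
    have e : H1.rep u t = H1.val u s + (primitive (H1.der u) t - primitive (H1.der u) s) := by
      rw [hs, H1.rep_eq_add_primitive hT u ht,
        H1.rep_eq_add_primitive hT u (Ioo_subset_Icc_self hs')]
      abel
    have b1 := norm_primitive_le (H1.der u) ht
    have b2 := norm_primitive_le (H1.der u) (Ioo_subset_Icc_self hs')
    have b3 : K * ‖H1.der u‖ ≤ K * ‖u‖ := by gcongr; exact H1.norm_der_le u
    rw [e]
    refine (norm_add_le _ _).trans ?_
    have := norm_sub_le (primitive (H1.der u) t) (primitive (H1.der u) s)
    linarith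
  have i1 : Integrable (fun s => ‖H1.val u s‖) (timeMeasure T) :=
    (integrable_Lp_time (H1.val u)).norm
  have h2 := integral_mono_ae (integrable_const _) (i1.add (integrable_const (2 * K * ‖u‖))) h1
  have h3 := integral_add i1 (integrable_const (μ := timeMeasure T) (2 * K * ‖u‖))
  rw [integral_const, hμ, smul_eq_mul] at h3
  rw [integral_const, hμ, smul_eq_mul] at h2
  have h4 := integral_norm_le_sqrt_mul_norm (H1.val u)
  have h5 : K * ‖H1.val u‖ ≤ K * ‖u‖ := by gcongr; exact WithLp.norm_fst_le _ u.1
  rw [div_mul_eq_mul_div, le_div_iff₀ hT]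
  have h6 := h2.trans h3.le
  linarith

theorem H1.rep_add (hT : 0 < T) (u v : H1 X T) {t : ℝ} (ht : t ∈ Icc 0 T) :
    H1.rep (u + v) t = H1.rep u t + H1.rep v t :=
  (H1.isContRep_rep _).eqOn hT (f' := fun t => H1.rep u t + H1.rep v t)
    (show IsContRep (u + v) _ from
      ⟨(H1.isContRep_rep u).1.add (H1.isContRep_rep v).1, (Lp.coeFn_add _ _).trans
        ((H1.isContRep_rep u).2.add (H1.isContRep_rep v).2)⟩) ht

theorem H1.rep_smul (hT : 0 < T) (c : ℝ) (u : H1 X T) {t : ℝ} (ht : t ∈ Icc 0 T) :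
    H1.rep (c • u) t = c • H1.rep u t :=
  (H1.isContRep_rep _).eqOn hT (f' := fun t => c • H1.rep u t)
    (show IsContRep (c • u) _ from
      ⟨(H1.isContRep_rep u).1.const_smul c, (Lp.coeFn_smul _ _).trans
        ((H1.isContRep_rep u).2.const_smul c)⟩) ht

/-- Point evaluation is weakly continuous on `H¹(I; X)`. -/
theorem TendstoWeakly.inner_rep (hT : 0 < T) {u : ℕ → H1 X T} {u₀ : H1 X T}
    (h : TendstoWeakly u u₀) {t : ℝ} (ht : t ∈ Icc 0 T) (e : X) :
    Tendsto (fun n => inner ℝ e (H1.rep (u n) t)) atTop (𝓝 (inner ℝ e (H1.rep u₀ t))) := by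
  obtain ⟨C, hC⟩ := H1.exists_norm_rep_le (X := X) hT
  exact h (LinearMap.mkContinuous
    { toFun := fun u => inner ℝ e (H1.rep u t)
      map_add' := fun u v => by rw [H1.rep_add hT u v ht, inner_add_right]
      map_smul' := fun c u => by
        rw [H1.rep_smul hT c u ht, inner_smul_right, RingHom.id_apply, smul_eq_mul] }
    (‖e‖ * C) fun u => by
      refine (norm_inner_le_norm _ _).trans ?_
      rw [mul_assoc]
      exact mul_le_mul_of_nonneg_left (hC u t ht) (norm_nonneg e))

/-- An operator which maps weakly null sequences to null sequences maps weakly convergent sequences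
of `H¹(I; X)` to strongly convergent sequences of `L²(I; Y)`: the values converge weakly at each
time, and they are uniformly bounded. -/
theorem TendstoWeakly.tendsto_val_map {Y : Type*} [NormedAddCommGroup Y] [InnerProductSpace ℝ Y]
    [CompleteSpace Y] (hT : 0 < T) {A : X →L[ℝ] Y}
    (hA : ∀ (f : ℕ → X) (M : ℝ), (∀ n, ‖f n‖ ≤ M) →
      (∀ e, Tendsto (fun n => inner ℝ e (f n)) atTop (𝓝 0)) →
      Tendsto (fun n => A (f n)) atTop (𝓝 0))
    {u : ℕ → H1 X T} {u₀ : H1 X T} (h : TendstoWeakly u u₀) :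
    Tendsto (fun n => H1.val (H1.map A (u n))) atTop (𝓝 (H1.val (H1.map A u₀))) := by
  obtain ⟨C, hC⟩ := H1.exists_norm_rep_le (X := X) hT
  obtain ⟨M, hM⟩ := h.exists_norm_le
  set B := |C| * M + |C| * ‖u₀‖ with hB
  have hbd : ∀ n, ∀ t ∈ Icc 0 T, ‖H1.rep (u n) t - H1.rep u₀ t‖ ≤ B := by
    intro n t ht
    have hC' : ∀ v : H1 X T, ‖H1.rep v t‖ ≤ |C| * ‖v‖ := fun v =>
      (hC v t ht).trans (by gcongr; exact le_abs_self C)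
    refine (norm_sub_le _ _).trans (add_le_add ((hC' _).trans ?_) (hC' _))
    gcongr
    exact hM n
  have e : ∀ n, ‖H1.val (H1.map A (u n)) - H1.val (H1.map A u₀)‖ ^ 2 =
      ∫ t in Ioo 0 T, ‖A (H1.rep (u n) t - H1.rep u₀ t)‖ ^ 2 := by
    intro n
    rw [Lp.norm_sq_eq_integral_norm_sq]
    refine integral_congr_ae ?_
    filter_upwards [Lp.coeFn_sub (H1.val (H1.map A (u n))) (H1.val (H1.map A u₀)),
      A.coeFn_compLp' (H1.val (u n)), A.coeFn_compLp' (H1.val u₀), (H1.isContRep_rep (u n)).2,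
      (H1.isContRep_rep u₀).2] with t h1 h2 h3 h4 h5
    rw [h1, Pi.sub_apply, H1.val_map, H1.val_map, h2, h3, h4, h5, map_sub]
  have lim : Tendsto (fun n => ∫ t in Ioo 0 T, ‖A (H1.rep (u n) t - H1.rep u₀ t)‖ ^ 2) atTop
      (𝓝 (∫ _ in Ioo 0 T, (0 : ℝ))) := by
    refine tendsto_integral_of_dominated_convergence (fun _ => (‖A‖ * B) ^ 2) (fun n => ?_)
      (integrable_const _) (fun n => ?_) ?_
    · have hc : ContinuousOn (fun t => ‖A (H1.rep (u n) t - H1.rep u₀ t)‖ ^ 2) (Icc 0 T) :=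
        (A.continuous.comp_continuousOn
          ((H1.isContRep_rep (u n)).1.sub (H1.isContRep_rep u₀).1)).norm.pow 2
      exact (hc.mono Ioo_subset_Icc_self).aestronglyMeasurable measurableSet_Ioo
    · filter_upwards [ae_restrict_mem measurableSet_Ioo] with t ht
      rw [Real.norm_of_nonneg (sq_nonneg _)]
      gcongr
      exact (A.le_opNorm _).trans (by gcongr; exact hbd n t (Ioo_subset_Icc_self ht))
    · filter_upwards [ae_restrict_mem measurableSet_Ioo] with t ht
      have ht' := Ioo_subset_Icc_self ht
      have h1 := hA (fun n => H1.rep (u n) t - H1.rep u₀ t) B (fun n => hbd n t ht') fun e => by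
        have h2 := (h.inner_rep hT ht' e).sub_const (inner ℝ e (H1.rep u₀ t))
        rw [sub_self] at h2
        exact h2.congr fun n => (inner_sub_right _ _ _).symm
      simpa using h1.norm.pow 2
  simp only [integral_zero] at lim
  rw [tendsto_iff_norm_sub_tendsto_zero]
  have l2 := (lim.congr fun n => (e n).symm).sqrt
  simpa [Real.sqrt_sq] using l2

end WeakData

section Domain
variable {d : ℕ} {Ω : BoundedOpen d} {T : ℝ}

/-- The set of compatible controls is weakly sequentially closed. -/
theorem TendstoWeakly.mem_compatibleControls (hT : 0 < T) {g : ℕ → H1 (L2 Ω) T}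
    {g₀ : H1 (L2 Ω) T} (h : TendstoWeakly g g₀) (hg : ∀ n, g n ∈ compatibleControls Ω T) :
    g₀ ∈ compatibleControls Ω T := by
  have lim : ∀ s (hs : MeasurableSet s),
      Tendsto (fun n => ∫ x in s, H1.rep (g n) 0 x ∂Ω.measure) atTop
        (𝓝 (∫ x in s, H1.rep g₀ 0 x ∂Ω.measure)) := by
    intro s hs
    have := h.inner_rep hT ⟨le_rfl, hT.le⟩
      (indicatorConstLp 2 hs (measure_ne_top Ω.measure s) (1 : ℝ))
    simpa only [L2.inner_indicatorConstLp_one] using this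
  have h1 : (fun x => H1.rep g₀ 0 x) ≤ᵐ[Ω.measure] fun _ => (1 : ℝ) := by
    refine ae_le_of_forall_setIntegral_le (integrable_L2 _) (integrable_const _) fun s hs _ => ?_
    refine le_of_tendsto' (lim s hs) fun n => ?_
    refine setIntegral_mono_ae (integrable_L2 _).integrableOn (integrable_const _).integrableOn ?_
    filter_upwards [hg n] with x hx
    exact (abs_le.1 hx).2
  have h2 : (fun _ => (-1 : ℝ)) ≤ᵐ[Ω.measure] fun x => H1.rep g₀ 0 x := by
    refine ae_le_of_forall_setIntegral_le (integrable_const _) (integrable_L2 _) fun s hs _ => ?_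
    refine ge_of_tendsto' (lim s hs) fun n => ?_
    refine setIntegral_mono_ae (integrable_const _).integrableOn (integrable_L2 _).integrableOn ?_
    filter_upwards [hg n] with x hx
    exact (abs_le.1 hx).1
  filter_upwards [h1, h2] with x a b
  exact abs_le.2 ⟨b, a⟩

/-! ### The state equations as evolutions in `H₀¹(Ω)` -/

variable [NeZero d] {r : ℝ → ℝ → ℝ} {ρ : ℝ}

/-- The Riesz representative in `H₀¹(Ω)` of a control, as an element of `H¹(I; H₀¹(Ω))`. -/
def dualControl (g : H1 (L2 Ω) T) : H1 (H01 Ω) T :=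
  H1.map (ContinuousLinearMap.adjoint H01.toL2) g

theorem inner_val_dualControl (g : H1 (L2 Ω) T) : ∀ᵐ t ∂timeMeasure T, ∀ w : H01 Ω,
    inner ℝ (H1.val (dualControl g) t) w = toHneg (H1.val g t) w := by
  filter_upwards [(ContinuousLinearMap.adjoint (H01.toL2 (Ω := Ω))).coeFn_compLp' (H1.val g)]
    with t ht w
  rw [dualControl, H1.val_map, ht, ContinuousLinearMap.adjoint_inner_left]
  rfl

theorem inner_rep_dualControl_le (hT : 0 < T) {g : H1 (L2 Ω) T}
    (hg : g ∈ compatibleControls Ω T) (w : H01 Ω) :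
    inner ℝ (H1.rep (dualControl g) 0) w ≤ dissipation w := by
  rw [dualControl, H1.rep_map hT _ _ ⟨le_rfl, hT.le⟩, ContinuousLinearMap.adjoint_inner_left,
    L2.inner_def]
  refine integral_mono_ae (L2.integrable_inner _ _) (integrable_L2 _).abs ?_
  filter_upwards [hg] with x hx
  refine (real_inner_le_norm _ _).trans ?_
  exact mul_le_of_le_one_left (abs_nonneg _) hx

theorem val_ae_eq_primitive (hT : 0 < T) (z : H1Star (H01 Ω) T) :
    H1.val z.1 =ᵐ[timeMeasure T] primitive (H1.der z.1) := by
  have h := coeFn_primitiveL2 (H1.der z.1)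
  rw [← val_primitiveH1, primitiveH1_der hT z] at h
  exact h

/-- The differential inclusion holds exactly if the Riesz representative of the control and the
velocity satisfy the variational inequality in `H₀¹(Ω)`. -/
theorem isSolution_iff (hT : 0 < T) (m : ℝ) (g : H1 (L2 Ω) T) (z : H1Star (H01 Ω) T) :
    IsSolution g z ↔ IsApproxSolution dissipation m 0 (H1.val (dualControl g)) (H1.der z.1) := by
  refine eventually_congr ?_
  filter_upwards [val_ae_eq_primitive hT z, inner_val_dualControl g] with t h1 h2
  have key : ∀ w, inner ℝ (H1.val (dualControl g) t - primitive (H1.der z.1) t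
      - (0 : ℝ) • H1.der z.1 t) w = (laplacian (H1.val z.1 t) + toHneg (H1.val g t)) w := by
    intro w
    rw [zero_smul, sub_zero, inner_sub_left, h2 w, ← h1, add_apply]
    simp only [laplacian, neg_apply, innerSL_apply_apply]
    ring
  constructor
  · rintro ⟨ξ, hξ, h0⟩ y
    rw [key, zero_mul, add_zero]
    have e : laplacian (H1.val z.1 t) + toHneg (H1.val g t) = ξ := by
      rw [sub_sub] at h0
      exact (sub_eq_zero.1 h0.symm).symm
    rw [e]
    linarith [hξ y]
  · intro h
    refine ⟨laplacian (H1.val z.1 t) + toHneg (H1.val g t), fun y => ?_, by abel⟩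
    have := h y
    rw [key] at this
    linarith

theorem isRegSolution_iff (hT : 0 < T) (hr : IsRegularizedAbs r) (hρ : 0 < ρ)
    (g : H1 (L2 Ω) T) (z : H1Star (H01 Ω) T) :
    IsRegSolution r ρ g z ↔ ∀ᵐ t ∂timeMeasure T,
      smoothGrad r ρ (H1.der z.1 t) + ρ • H1.der z.1 t + primitive (H1.der z.1) t =
        H1.val (dualControl g) t := by
  refine eventually_congr ?_
  filter_upwards [val_ae_eq_primitive hT z, inner_val_dualControl g] with t h1 h2
  have key : ∀ w, inner ℝ (smoothGrad r ρ (H1.der z.1 t) + ρ • H1.der z.1 t +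
      primitive (H1.der z.1) t) w =
      (∫ x in Ω.carrier, deriv (r ρ) (H01.toL2 (H1.der z.1 t) x) * H01.toL2 w x)
      - ρ * laplacian (H1.der z.1 t) w - laplacian (H1.val z.1 t) w := by
    intro w
    rw [inner_add_left, inner_add_left, inner_smoothGrad hr hρ, real_inner_smul_left, ← h1]
    simp only [laplacian, neg_apply, innerSL_apply_apply]
    ring
  constructor
  · intro h
    refine ext_inner_right ℝ fun w => ?_
    rw [key, h w, h2]
  · intro h w
    rw [← key, h, h2]

theorem solOp_spec {g : H1 (L2 Ω) T} (h : ∃ z, IsSolution g z) : IsSolution g (solOp g) := by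
  rw [solOp, dif_pos h]
  exact h.choose_spec

theorem regSolOp_spec {g : H1 (L2 Ω) T} (h : ∃ z, IsRegSolution r ρ g z) :
    IsRegSolution r ρ g (regSolOp r ρ g) := by
  rw [regSolOp, dif_pos h]
  exact h.choose_spec

theorem isSolution_solOp (hT : 0 < T) (hr : IsRegularizedAbs r) {g : H1 (L2 Ω) T}
    (hg : g ∈ compatibleControls Ω T) : IsSolution g (solOp g) := by
  obtain ⟨u, hu⟩ := exists_isApproxSolution_zero hT measureReal_nonneg
    (fun ρ hρ => isSmoothing_smoothDissipation (Ω := Ω) hr hρ) dissipation_zero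
    integrable_dissipation (dualControl g) (inner_rep_dualControl_le hT hg)
  exact solOp_spec ⟨primitiveH1 _ T u, (isSolution_iff hT _ g _).2 hu⟩

theorem isRegSolution_regSolOp (hT : 0 < T) (hr : IsRegularizedAbs r) (hρ : 0 < ρ)
    (g : H1 (L2 Ω) T) : IsRegSolution r ρ g (regSolOp r ρ g) := by
  obtain ⟨u, hu, -⟩ := (isSmoothing_smoothDissipation (Ω := Ω) hr hρ).existsUnique hT hρ
    (H1.val (dualControl g))
  exact regSolOp_spec ⟨primitiveH1 _ T u, (isRegSolution_iff hT hr hρ g _).2 hu⟩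

theorem eq_of_der_eq (hT : 0 < T) {z z' : H1Star (H01 Ω) T} (h : H1.der z.1 = H1.der z'.1) :
    z = z' := by
  rw [← primitiveH1_der hT z, h, primitiveH1_der hT z']

theorem IsSolution.unique (hT : 0 < T) {g : H1 (L2 Ω) T} {z z' : H1Star (H01 Ω) T}
    (h : IsSolution g z) (h' : IsSolution g z') : z = z' :=
  eq_of_der_eq hT (((isSolution_iff hT 0 g z).1 h).unique hT le_rfl
    ((isSolution_iff hT 0 g z').1 h'))

theorem IsRegSolution.unique (hT : 0 < T) (hr : IsRegularizedAbs r) (hρ : 0 < ρ)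
    {g : H1 (L2 Ω) T} {z z' : H1Star (H01 Ω) T} (h : IsRegSolution r ρ g z)
    (h' : IsRegSolution r ρ g z') : z = z' :=
  eq_of_der_eq hT (((isSmoothing_smoothDissipation (Ω := Ω) hr hρ).existsUnique hT hρ _).unique
    ((isRegSolution_iff hT hr hρ g z).1 h) ((isRegSolution_iff hT hr hρ g z').1 h'))

theorem toC_eq_primitiveC_der (hT : 0 < T) (z : H1Star (H01 Ω) T) :
    H1.toC z.1 = primitiveC _ T (H1.der z.1) := by
  rw [← toC_primitiveH1 hT, primitiveH1_der hT]

theorem isApproxSolution_der_regSolOp (hT : 0 < T) (hr : IsRegularizedAbs r) (hρ : 0 < ρ)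
    (g : H1 (L2 Ω) T) :
    IsApproxSolution dissipation (Ω.measure.real univ) ρ (H1.val (dualControl g))
      (H1.der (regSolOp r ρ g).1) :=
  (isSmoothing_smoothDissipation hr hρ).isApproxSolution
    ((isRegSolution_iff hT hr hρ g _).1 (isRegSolution_regSolOp hT hr hρ g))

/-- Convergence of the regularized solutions. The energy estimate bounds their velocities, and the
data converge strongly in `L²(I; H⁻¹(Ω))` by Rellich's theorem, so that they can be compared with
the limit. -/
theorem tendsto_regSolOp (hT : 0 < T) (hr : IsRegularizedAbs r) {gs : ℕ → H1 (L2 Ω) T}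
    {g : H1 (L2 Ω) T} {ρ : ℕ → ℝ} (hgs : ∀ n, gs n ∈ compatibleControls Ω T)
    (hg : TendstoWeakly gs g) (hρ : ∀ n, 0 < ρ n) (hρ0 : Tendsto ρ atTop (𝓝 0)) :
    TendstoWeakly (fun n => regSolOp r (ρ n) (gs n)) (solOp g) ∧
      Tendsto (fun n => H1.toC (regSolOp r (ρ n) (gs n)).1) atTop (𝓝 (H1.toC (solOp g).1)) := by
  have hgC := hg.mem_compatibleControls hT hgs
  set m := Ω.measure.real univ with hm
  set A : L2 Ω →L[ℝ] H01 Ω := ContinuousLinearMap.adjoint H01.toL2 with hA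
  obtain ⟨N, hN⟩ := hg.exists_norm_le
  obtain ⟨R, hR⟩ := hρ0.bddAbove_range
  have hder : ∀ n, ‖H1.der (dualControl (gs n))‖ ≤ ‖A‖ * N := fun n => by
    refine (A.norm_compLp_le _).trans ?_
    gcongr
    exact (H1.norm_der_le _).trans (hN n)
  have hM : ∀ n, ‖H1.der (regSolOp r (ρ n) (gs n)).1‖ ≤
      Real.sqrt ((‖A‖ * N) ^ 2 + 2 * (R * m)) := fun n => by
    refine Real.le_sqrt_of_sq_le ?_
    have h1 := (isSmoothing_smoothDissipation (Ω := Ω) hr (hρ n)).norm_sq_le hT (hρ n)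
      dissipation_zero (dualControl (gs n)) (inner_rep_dualControl_le hT (hgs n))
      ((isRegSolution_iff hT hr (hρ n) _ _).1 (isRegSolution_regSolOp hT hr (hρ n) (gs n)))
    refine h1.trans ?_
    gcongr
    · exact hder n
    · exact hR ⟨n, rfl⟩
  have hℓ : Tendsto (fun n => H1.val (dualControl (gs n))) atTop (𝓝 (H1.val (dualControl g))) :=
    hg.tendsto_val_map hT fun f M hf he => tendsto_adjoint_toL2_of_tendsto_weakly hf he
  obtain ⟨h1, h2⟩ := IsApproxSolution.tendsto hT (measureReal_nonneg (μ := Ω.measure)) hρ hρ0 hM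
    (fun n => isApproxSolution_der_regSolOp hT hr (hρ n) (gs n))
    ((isSolution_iff hT m g _).1 (isSolution_solOp hT hr hgC)) hℓ
  refine ⟨fun f => ?_, ?_⟩
  · have h3 := h2 (f.comp (primitiveH1 _ T))
    simpa only [ContinuousLinearMap.comp_apply, primitiveH1_der hT] using h3
  · simpa only [toC_eq_primitiveC_der hT] using h1

/-- The convergence rate: the comparison estimate for one control, in which only the velocity of the
unregularized solution enters. -/
theorem norm_toC_solOp_sub_regSolOp_le (hT : 0 < T) (hr : IsRegularizedAbs r) (hρ : 0 < ρ)
    {g : H1 (L2 Ω) T} (hg : g ∈ compatibleControls Ω T) :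
    ‖H1.toC (solOp g).1 - H1.toC (regSolOp r ρ g).1‖ ≤
      Real.sqrt (1 / 2 + 2 * (Ω.measure.real univ * T)) * (1 + ‖solOp g‖) * ρ ^ (1 / 2 : ℝ) := by
  set m := Ω.measure.real univ with hm
  have hm0 : 0 ≤ m := measureReal_nonneg
  have h1 := ((isSolution_iff hT m g _).1 (isSolution_solOp hT hr hg)).norm_primitiveC_sub_le hT
    hm0 le_rfl hρ.le (isApproxSolution_der_regSolOp hT hr hρ g)
  rw [← toC_eq_primitiveC_der hT, ← toC_eq_primitiveC_der hT] at h1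
  refine h1.trans ?_
  have h2 : ‖H1.der (solOp g).1‖ ≤ ‖solOp g‖ := H1.norm_der_le _
  rw [← Real.sqrt_eq_rpow, ← Real.sqrt_sq (by positivity : 0 ≤ 1 + ‖solOp g‖),
    ← Real.sqrt_mul (by positivity), ← Real.sqrt_mul (by positivity)]
  refine Real.sqrt_le_sqrt ?_
  rw [sub_self, norm_zero, zero_mul, zero_div, zero_mul, zero_add, zero_add, zero_add]
  have h3 : ‖H1.der (solOp g).1‖ ^ 2 ≤ (1 + ‖solOp g‖) ^ 2 := by
    gcongr
    linarith
  have h4 : 1 ≤ (1 + ‖solOp g‖) ^ 2 := one_le_pow₀ (by linarith [norm_nonneg (solOp g)])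
  have h5 := mul_le_mul_of_nonneg_left h4 (by positivity : 0 ≤ ρ * (m * T))
  have h6 := mul_le_mul_of_nonneg_left h3 hρ.le
  nlinarith

end Domain

end

theorem mainTheorem5 (d : ℕ) [NeZero d] (Ω : BoundedOpen d) (T : ℝ) (hT : 0 < T)
    (r : ℝ → ℝ → ℝ) (hr : IsRegularizedAbs r) :
    -- the operators `S` and `S_ρ` are well defined
    (∀ g ∈ compatibleControls Ω T,
      IsSolution g (solOp g) ∧ ∀ z, IsSolution g z → z = solOp g) ∧
    (∀ ρ > 0, ∀ g : H1 (L2 Ω) T,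
      IsRegSolution r ρ g (regSolOp r ρ g) ∧ ∀ z, IsRegSolution r ρ g z → z = regSolOp r ρ g) ∧
    -- convergence
    (∀ (gs : ℕ → H1 (L2 Ω) T) (g : H1 (L2 Ω) T) (ρ : ℕ → ℝ),
      (∀ n, gs n ∈ compatibleControls Ω T) → TendstoWeakly gs g →
      (∀ n, 0 < ρ n) → Tendsto ρ atTop (𝓝 0) →
      g ∈ compatibleControls Ω T ∧
      TendstoWeakly (fun n => regSolOp r (ρ n) (gs n)) (solOp g) ∧
      Tendsto (fun n => H1.toC (regSolOp r (ρ n) (gs n)).1) atTop (𝓝 (H1.toC (solOp g).1))) ∧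
    -- rate for a fixed control
    (∃ C > 0, ∀ g ∈ compatibleControls Ω T, ∀ ρ > 0,
      ‖H1.toC (solOp g).1 - H1.toC (regSolOp r ρ g).1‖
        ≤ C * (1 + ‖solOp g‖) * ρ ^ (1 / 2 : ℝ)) := by
  refine ⟨fun g hg => ⟨isSolution_solOp hT hr hg, fun z hz =>
      hz.unique hT (isSolution_solOp hT hr hg)⟩,
    fun ρ hρ g => ⟨isRegSolution_regSolOp hT hr hρ g, fun z hz =>
      hz.unique hT hr hρ (isRegSolution_regSolOp hT hr hρ g)⟩,
    fun gs g ρ hgs hg hρ hρ0 => ⟨hg.mem_compatibleControls hT hgs,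
      tendsto_regSolOp hT hr hgs hg hρ hρ0⟩,
    Real.sqrt (1 / 2 + 2 * (Ω.measure.real univ * T)), by positivity, fun g hg ρ hρ =>
      norm_toC_solOp_sub_regSolOp_le hT hr hρ hg⟩
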